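/- \textbf{Theorem.} Let $\hat f(z)=\sum_{p\ge 1} f_p z^p\in\mathbb{C}[[z]]$. The following statements are equivalent. (1) There are a polynomial $P\in\mathbb{C}[z]$ with $P(0)\neq 0$ and a power series $g\in\mathbb{C}\{z\}$ with positive radius of convergence such that $\hat f$ is a formal solution of $P(z^2\partial_z+z)\,y=g(z)$. (2) There are an integer $r\ge 1$, complex numbers $a_1,\dots,a_r$ and real constants $C,M>0$ such that for every integer $j>r$ $$\Big|\frac{f_j}{j!}-\sum_{k=j-r}^{j-1}a_{j-k}\frac{f_k}{k!}\Big|\le \frac{CM^j}{j!}.$$ (3) There are an integer $r\ge 1$, complex numbers $a_1,\dots,a_r$, a polynomial $P\in\mathbb{C}[z]$ with $P(0)\ne 0$ and a power series $g\in\mathbb{C}\{z\}$ with positive radius of convergence such that, for every $d\in\mathbb{R}$ that is not an argument of a root of $h(z)=1-a_1z-\dots-a_rz^r$, the series $\hat f$ is $1$-summable in direction $d$, and its $1$-sum $f$ in direction $d$, on every sector $S_d(\theta,\rho)$ with $\theta>1$ and $\rho>0$ on which it is defined, is an actual solution of $P(z^2\partial_z+z)\,y=g(z)$, that is, the equation holds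 at all points of $S_d(\theta,\rho)$ lying in the open disc of convergence of $g$. Here $P$ and $g$ do not depend on $d$. Here $S_d(\theta,\rho)=\{z:|\arg z-d|<\pi\theta/2,\ 0<|z|<\rho\}$ is a sector of the Riemann surface of the logarithm. A holomorphic function $f$ on $S_d(\theta,\rho)$ with $\theta>1$ is a $1$-sum of $\hat f$ in direction $d$ if for every sector $T$ of finite radius with $\overline{T}\setminus\{0\}\subset S_d(\theta,\rho)$ there are $C,A>0$ with $\big|f(z)-\sum_{p=0}^{N-1}f_pz^p\big|\le CA^N N!\,|z|^N$ for all integers $N\ge 0$ and $z\in T$. The series $\hat f$ is $1$-summable in direction $d$ if such $\theta>1$, $\rho>0$ and $f$ exist. -/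

import Mathlib

noncomputable section

namespace OneSummability

/-- The operator `z² ∂_z + z` acting on formal power series. -/
def formalOp : PowerSeries ℂ →ₗ[ℂ] PowerSeries ℂ :=
  LinearMap.mulLeft ℂ ((PowerSeries.X : PowerSeries ℂ) ^ 2) ∘ₗ
      (PowerSeries.derivative ℂ : PowerSeries ℂ →ₗ[ℂ] PowerSeries ℂ) +
    LinearMap.mulLeft ℂ (PowerSeries.X : PowerSeries ℂ)

/-- `y` is a formal solution of `P(z² ∂_z + z) y = g`. -/
def IsFormalSolution (P : Polynomial ℂ) (g y : PowerSeries ℂ) : Prop :=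
  Polynomial.aeval (R := ℂ) (formalOp : Module.End ℂ (PowerSeries ℂ)) P y = g

/-- The radius of convergence of a power series. -/
def convRadius (g : PowerSeries ℂ) : ENNReal :=
  (FormalMultilinearSeries.ofScalars ℂ (fun n => PowerSeries.coeff n g)).radius

/-- `g ∈ ℂ{z}`. -/
def IsConvergent (g : PowerSeries ℂ) : Prop := 0 < convRadius g

/-- The bounded sector `S_d(θ, ρ) = {z : |arg z - d| < πθ/2, 0 < |z| < ρ}` of the Riemann surface of
the logarithm. That surface is identified with `ℂ` through its global coordinate `w = log z`: the
point `w` lies above `z = exp w`, with `arg z = Im w` and `|z| = exp (Re w)`. The vertex `0` is not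
a point of the surface. A function on a part of the surface is given as a function of `w`, and it
is holomorphic if and only if it is holomorphic in `w`. -/
def sector (d θ ρ : ℝ) : Set ℂ :=
  {w | |w.im - d| < Real.pi * θ / 2 ∧ Real.exp w.re < ρ}

/-- `F` has the formal power series `fhat` as its Gevrey asymptotic expansion of order one in the
sector `S_d(θ, ρ)`: on every bounded proper subsector `T` the `N`-th remainder is bounded by
`C A^N N! |z|^N`, with `C` and `A` depending only on `T`. -/
def HasGevreyOneExpansion (d θ ρ : ℝ) (F : ℂ → ℂ) (fhat : PowerSeries ℂ) : Prop :=
  ∀ d' θ' ρ' : ℝ, 0 < θ' → 0 < ρ' → closure (sector d' θ' ρ') ⊆ sector d θ ρ →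
    ∃ C A : ℝ, 0 < C ∧ 0 < A ∧ ∀ N : ℕ, ∀ w ∈ sector d' θ' ρ',
      ‖F w - ∑ p ∈ Finset.range N, PowerSeries.coeff p fhat * Complex.exp w ^ p‖ ≤
        C * A ^ N * (N.factorial : ℝ) * ‖Complex.exp w‖ ^ N

/-- `F` is a `1`-sum of `fhat` in the direction `d`, on the sector `S_d(θ, ρ)`, whose opening `πθ`
is larger than `π`. -/
def IsOneSum (fhat : PowerSeries ℂ) (d θ ρ : ℝ) (F : ℂ → ℂ) : Prop :=
  1 < θ ∧ 0 < ρ ∧ DifferentiableOn ℂ F (sector d θ ρ) ∧ HasGevreyOneExpansion d θ ρ F fhat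

/-- `fhat` is `1`-summable in the direction `d`. -/
def IsOneSummable (fhat : PowerSeries ℂ) (d : ℝ) : Prop :=
  ∃ (θ ρ : ℝ) (F : ℂ → ℂ), IsOneSum fhat d θ ρ F

/-- The derivative `∂_z` in the coordinate `w = log z`. -/
def dz (F : ℂ → ℂ) : ℂ → ℂ := fun w => (Complex.exp w)⁻¹ * deriv F w

/-- The operator `z² ∂_z + z` acting on functions on the Riemann surface of the logarithm. -/
def analyticOp (F : ℂ → ℂ) : ℂ → ℂ :=
  fun w => Complex.exp w ^ 2 * dz F w + Complex.exp w * F w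

/-- The function `P(z² ∂_z + z) F`. -/
def polyOp (P : Polynomial ℂ) (F : ℂ → ℂ) : ℂ → ℂ :=
  fun w => P.sum (fun m c => c * (analyticOp^[m] F) w)

/-- `F` solves `P(z² ∂_z + z) y = g` at all points of the sector `S_d(θ, ρ)` that lie in the
open disc of convergence of `g`. -/
def IsActualSolution (P : Polynomial ℂ) (g : PowerSeries ℂ) (d θ ρ : ℝ) (F : ℂ → ℂ) : Prop :=
  ∀ w ∈ sector d θ ρ, ‖Complex.exp w‖ₑ < convRadius g →
    HasSum (fun n : ℕ => PowerSeries.coeff n g * Complex.exp w ^ n) (polyOp P F w)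

/-- The polynomial `h(z) = 1 - a_1 z - ⋯ - a_r z^r`. -/
def charPoly (r : ℕ) (a : ℕ → ℂ) : Polynomial ℂ :=
  1 - ∑ i ∈ Finset.Icc 1 r, Polynomial.C (a i) * Polynomial.X ^ i

/-- The real number `d` is an argument of the nonzero complex number `ζ`. -/
def IsArgument (d : ℝ) (ζ : ℂ) : Prop :=
  ζ = (‖ζ‖ : ℂ) * Complex.exp ((d : ℂ) * Complex.I)

end OneSummability

end

/-! The operator z²∂_z + z sends zⁿ to (n+1)zⁿ⁺¹, so the formal Borel transform B, dividing the n-th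
coefficient by n!, turns it into multiplication by the variable. Hence P(z²∂_z + z)f = g becomes P ·
Bf = Bg (`borel_aeval`), a linear recurrence with constant coefficients for f_n/n! with right-hand
side g_n/n!. Convergence of g means |g_n| ≤ CMⁿ, and P is a nonzero scalar times some 1 - a₁z - ⋯ -
a_r zʳ; this is (1) ⇔ (2).

For (1) ⇒ (3), Bf = Bg/P with Bg entire of exponential type. On a thin closed sector around a
direction free of roots of P the quotient is holomorphic and of exponential growth. Its Laplace
integrals along the rays of this sector agree where they overlap, by Cauchy's theorem
(`rayLaplace_eq_of_forall`); the two extreme rays together give a 1-sum on an opening larger than π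
(`isOneSummable_of_borel`).

An arbitrary 1-sum F is handled without the integral. Gevrey expansions pass through the operator
(`HasGevreyOneExpansion.analyticOp`), so P(z²∂_z + z)F - g has the zero expansion. It is then
exponentially small on an opening larger than π and vanishes by Phragmén–Lindelöf
(`HasGevreyOneExpansion.eqOn_zero`).

For (3) ⇒ (1) one admissible direction suffices: near the vertex P(z²∂_z + z)F equals the sum of g,
so P(z²∂_z + z)f and g are expansions of the same function, and expansions are unique. -/

namespace OneSummability

open Finset

/-! ### The formal Borel transform -/

/-- The coefficient of `z^(n+1)` is multiplied by `n + 1` under `z² ∂_z + z`. -/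
lemma coeff_succ_formalOp (f : PowerSeries ℂ) (n : ℕ) :
    PowerSeries.coeff (n + 1) (formalOp f) = (n + 1 : ℂ) * PowerSeries.coeff n f := by
  have h1 : formalOp f = PowerSeries.X ^ 2 * PowerSeries.derivative ℂ f + PowerSeries.X * f := rfl
  rw [h1, map_add, PowerSeries.coeff_succ_X_mul]
  rcases n with _ | n
  · simp [PowerSeries.coeff_X_pow_mul']
  · rw [PowerSeries.coeff_X_pow_mul', if_pos (by omega), PowerSeries.coeff_derivative]
    have : n + 1 + 1 - 2 + 1 = n + 1 := by omega
    rw [this]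
    have : n + 1 + 1 - 2 = n := by omega
    rw [this]; push_cast; ring

lemma coeff_zero_formalOp (f : PowerSeries ℂ) : PowerSeries.coeff 0 (formalOp f) = 0 := by
  have h1 : formalOp f = PowerSeries.X ^ 2 * PowerSeries.derivative ℂ f + PowerSeries.X * f := rfl
  rw [h1]; simp

/-- The formal Borel transform `∑ f_n z^n ↦ ∑ f_n / n! z^n`. -/
noncomputable def borel (f : PowerSeries ℂ) : PowerSeries ℂ :=
  PowerSeries.mk fun n => PowerSeries.coeff n f / (n.factorial : ℂ)

@[simp] lemma coeff_borel (f : PowerSeries ℂ) (n : ℕ) :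
    PowerSeries.coeff n (borel f) = PowerSeries.coeff n f / (n.factorial : ℂ) := by
  simp [borel]

lemma coeff_eq_factorial_mul_borel (f : PowerSeries ℂ) (n : ℕ) :
    PowerSeries.coeff n f = (n.factorial : ℂ) * PowerSeries.coeff n (borel f) := by
  have : (n.factorial : ℂ) ≠ 0 := by exact_mod_cast n.factorial_ne_zero
  rw [coeff_borel]; field_simp

/-- The factor n + 1 produced by the operator is exactly (n+1)!/n!, so division by factorials
removes it and leaves a pure shift. -/
lemma borel_formalOp (f : PowerSeries ℂ) : borel (formalOp f) = PowerSeries.X * borel f := by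
  ext n
  rcases n with _ | n
  · simp [coeff_zero_formalOp]
  · have h1 : (n.factorial : ℂ) ≠ 0 := by exact_mod_cast n.factorial_ne_zero
    have h2 : (n + 1 : ℂ) ≠ 0 := by exact_mod_cast n.succ_ne_zero
    rw [PowerSeries.coeff_succ_X_mul, coeff_borel, coeff_borel, coeff_succ_formalOp,
      Nat.factorial_succ]
    push_cast
    field_simp

lemma borel_add (f g : PowerSeries ℂ) : borel (f + g) = borel f + borel g := by
  ext n; simp [add_div]

lemma borel_smul (c : ℂ) (f : PowerSeries ℂ) : borel (c • f) = c • borel f := by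
  ext n; simp [mul_div_assoc]

lemma borel_formalOp_pow (m : ℕ) (f : PowerSeries ℂ) :
    borel (((formalOp : Module.End ℂ (PowerSeries ℂ)) ^ m) f) = PowerSeries.X ^ m * borel f := by
  induction m with
  | zero => simp
  | succ m ih => rw [pow_succ', Module.End.mul_apply, borel_formalOp, ih, pow_succ']; ring

/-- The Borel transform turns `P(z² ∂_z + z)` into multiplication by `P`. -/
lemma borel_aeval (P : Polynomial ℂ) (f : PowerSeries ℂ) :
    borel (Polynomial.aeval (R := ℂ) (formalOp : Module.End ℂ (PowerSeries ℂ)) P f) =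
      (P : PowerSeries ℂ) * borel f := by
  induction P using Polynomial.induction_on' with
  | add p q hp hq => simp only [map_add, LinearMap.add_apply, borel_add, hp, hq,
      Polynomial.coe_add, add_mul]
  | monomial n a =>
    rw [Polynomial.aeval_monomial, Module.End.mul_apply, Module.algebraMap_end_apply, borel_smul,
      borel_formalOp_pow, ← Polynomial.C_mul_X_pow_eq_monomial, Polynomial.coe_mul,
      Polynomial.coe_C, Polynomial.coe_pow, Polynomial.coe_X, PowerSeries.smul_eq_C_mul, mul_assoc]

lemma aeval_formalOp_apply (P : Polynomial ℂ) (f : PowerSeries ℂ) :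
    Polynomial.aeval (R := ℂ) (formalOp : Module.End ℂ (PowerSeries ℂ)) P f =
      ∑ m ∈ P.support, P.coeff m • ((formalOp : Module.End ℂ (PowerSeries ℂ)) ^ m) f := by
  rw [Polynomial.aeval_def, Polynomial.eval₂_eq_sum, Polynomial.sum_def, LinearMap.sum_apply]
  rfl

/-! ### Convergent series and geometric bounds -/

lemma norm_ofScalars_coeff (g : PowerSeries ℂ) (n : ℕ) :
    ‖FormalMultilinearSeries.ofScalars ℂ (fun n => PowerSeries.coeff n g) n‖ =
      ‖PowerSeries.coeff n g‖ := FormalMultilinearSeries.ofScalars_norm ℂ _ n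

/-- Inside the disc of convergence the coefficients are geometrically bounded. -/
lemma exists_norm_coeff_le_of_lt_convRadius {g : PowerSeries ℂ} {r : ℝ} (hr : 0 < r)
    (h : ENNReal.ofReal r < convRadius g) :
    ∃ C > 0, ∀ n, ‖PowerSeries.coeff n g‖ ≤ C * (r⁻¹) ^ n := by
  obtain ⟨C, hC, hb⟩ := FormalMultilinearSeries.norm_mul_pow_le_of_lt_radius _ h
  refine ⟨C, hC, fun n => ?_⟩
  have := hb n
  rw [norm_ofScalars_coeff, Real.coe_toNNReal r hr.le] at this
  rw [inv_pow, ← div_eq_mul_inv, le_div_iff₀ (by positivity)]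
  exact this

/-- Replaces the radius of convergence by the explicit bound that appears in statement (2). -/
lemma isConvergent_iff (g : PowerSeries ℂ) :
    IsConvergent g ↔ ∃ C M : ℝ, 0 < C ∧ 0 < M ∧ ∀ n, ‖PowerSeries.coeff n g‖ ≤ C * M ^ n := by
  constructor
  · intro h
    obtain ⟨r, hr, hr'⟩ := ENNReal.lt_iff_exists_nnreal_btwn.mp h
    have hr0 : (0 : ℝ) < r := by exact_mod_cast hr
    obtain ⟨C, hC, hb⟩ := exists_norm_coeff_le_of_lt_convRadius hr0
      (by rwa [ENNReal.ofReal_coe_nnreal])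
    exact ⟨C, _, hC, inv_pos.mpr hr0, hb⟩
  · rintro ⟨C, M, hC, hM, hb⟩
    have hM' : 0 ≤ M⁻¹ := by positivity
    have := FormalMultilinearSeries.le_radius_of_bound
      (FormalMultilinearSeries.ofScalars ℂ (fun n => PowerSeries.coeff n g)) C
      (r := Real.toNNReal M⁻¹) (fun n => by
        rw [norm_ofScalars_coeff]
        rw [Real.coe_toNNReal _ hM', inv_pow, ← div_eq_mul_inv, div_le_iff₀ (by positivity)]
        exact hb n)
    refine lt_of_lt_of_le ?_ this
    exact ENNReal.ofReal_pos.mpr (inv_pos.mpr hM)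

/-! ### The equation as a recurrence: (1) ⇔ (2) -/

/-- The condition `r < j` keeps every index j - i positive, so no term of the product is cut off and
the truncated subtractions are genuine. -/
lemma coeff_charPoly_mul (r : ℕ) (a : ℕ → ℂ) (φ : PowerSeries ℂ) (j : ℕ) (hj : r < j) :
    PowerSeries.coeff j ((charPoly r a : PowerSeries ℂ) * φ) =
      PowerSeries.coeff j φ -
        ∑ k ∈ Icc (j - r) (j - 1), a (j - k) * PowerSeries.coeff k φ := by
  have h1 : (charPoly r a : PowerSeries ℂ) =
      1 - ∑ i ∈ Icc 1 r, PowerSeries.C (a i) * PowerSeries.X ^ i := by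
    rw [charPoly, ← Polynomial.coeToPowerSeries.ringHom_apply, map_sub, map_sum]
    simp [Polynomial.coeToPowerSeries.ringHom_apply]
  rw [h1, sub_mul, one_mul, map_sub, Finset.sum_mul, map_sum]
  congr 1
  refine Finset.sum_bij' (fun i _ => j - i) (fun k _ => j - k) ?_ ?_ ?_ ?_ ?_
  · intro i hi; simp only [mem_Icc] at *; omega
  · intro i hi; simp only [mem_Icc] at *; omega
  · intro i hi; simp only [mem_Icc] at *; omega
  · intro i hi; simp only [mem_Icc] at *; omega
  · intro i hi
    simp only [mem_Icc] at hi
    rw [mul_assoc, PowerSeries.coeff_C_mul, PowerSeries.coeff_X_pow_mul', if_pos (by omega)]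
    congr 2; omega

lemma eval_zero_charPoly (r : ℕ) (a : ℕ → ℂ) : (charPoly r a).eval 0 = 1 := by
  simp only [charPoly, Polynomial.eval_sub, Polynomial.eval_one, Polynomial.eval_finsetSum,
    Polynomial.eval_mul, Polynomial.eval_C, Polynomial.eval_pow, Polynomial.eval_X]
  rw [Finset.sum_eq_zero, sub_zero]
  intro i hi
  simp only [mem_Icc] at hi
  simp [show i ≠ 0 by omega]

/-- A polynomial with nonzero constant term is a multiple of some `charPoly`. -/
lemma eq_C_mul_charPoly (P : Polynomial ℂ) (hP : P.eval 0 ≠ 0) :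
    P = Polynomial.C (P.eval 0) *
      charPoly (max 1 P.natDegree) (fun i => - P.coeff i / P.eval 0) := by
  ext n
  rw [Polynomial.coeff_C_mul, charPoly, Polynomial.coeff_sub, Polynomial.finsetSum_coeff]
  simp only [Polynomial.coeff_C_mul, Polynomial.coeff_X_pow, mul_ite, mul_one, mul_zero,
    Finset.sum_ite_eq, Polynomial.coeff_one]
  rcases Nat.eq_zero_or_pos n with rfl | hn
  · simp [Polynomial.coeff_zero_eq_eval_zero]
  · rw [if_neg (by omega)]
    split_ifs with h
    · field_simp; ring
    · rw [Polynomial.coeff_eq_zero_of_natDegree_lt]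
      · simp
      · simp only [mem_Icc] at h; omega

lemma recurrence_of_isFormalSolution (P : Polynomial ℂ) (g f : PowerSeries ℂ)
    (hP : P.eval 0 ≠ 0) (hg : IsConvergent g) (h : IsFormalSolution P g f) :
    ∃ (r : ℕ) (a : ℕ → ℂ) (C M : ℝ), 1 ≤ r ∧ 0 < C ∧ 0 < M ∧ ∀ j : ℕ, r < j →
        ‖PowerSeries.coeff j f / (j.factorial : ℂ) -
            ∑ k ∈ Finset.Icc (j - r) (j - 1),
              a (j - k) * (PowerSeries.coeff k f / (k.factorial : ℂ))‖ ≤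
          C * M ^ j / (j.factorial : ℝ) := by
  obtain ⟨C, M, hC, hM, hb⟩ := (isConvergent_iff g).mp hg
  -- The coefficients are those of P/P(0), which is why `C` is divided by |P(0)|; the maximum with 1
  -- covers constant P.
  refine ⟨max 1 P.natDegree, fun i => - P.coeff i / P.eval 0, C / ‖P.eval 0‖, M,
    le_max_left _ _, by positivity, hM, fun j hj => ?_⟩
  have h1 := borel_aeval P f
  rw [show Polynomial.aeval (R := ℂ) (formalOp : Module.End ℂ (PowerSeries ℂ)) P f = g from h] at h1
  have h2 := congrArg (PowerSeries.coeff j) h1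
  rw [eq_C_mul_charPoly P hP, Polynomial.coe_mul, Polynomial.coe_C, mul_assoc,
    PowerSeries.coeff_C_mul, coeff_charPoly_mul _ _ _ _ hj] at h2
  simp only [coeff_borel] at h2
  have h0 : 0 < ‖P.eval 0‖ := norm_pos_iff.mpr hP
  have h3 := congrArg norm h2
  rw [norm_mul, norm_div, Complex.norm_natCast] at h3
  rw [div_mul_eq_mul_div, div_div, le_div_iff₀ (by positivity), mul_comm ‖P.eval 0‖, ← mul_assoc,
    mul_right_comm, mul_comm _ ‖P.eval 0‖, ← h3]
  have hj0 : (0 : ℝ) < j.factorial := by exact_mod_cast j.factorial_pos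
  rw [div_mul_cancel₀ _ hj0.ne']
  exact hb j

lemma isFormalSolution_of_recurrence (f : PowerSeries ℂ) (r : ℕ) (a : ℕ → ℂ) (C M : ℝ)
    (hC : 0 < C) (hM : 0 < M) (h : ∀ j : ℕ, r < j →
        ‖PowerSeries.coeff j f / (j.factorial : ℂ) -
            ∑ k ∈ Finset.Icc (j - r) (j - 1),
              a (j - k) * (PowerSeries.coeff k f / (k.factorial : ℂ))‖ ≤
          C * M ^ j / (j.factorial : ℝ)) :
    ∃ (P : Polynomial ℂ) (g : PowerSeries ℂ), P.eval 0 ≠ 0 ∧ IsConvergent g ∧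
      IsFormalSolution P g f := by
  -- The series g is taken to be the left-hand side itself, so the equation is `rfl` and only
  -- convergence remains.
  refine ⟨charPoly r a, _, by simp [eval_zero_charPoly], (isConvergent_iff _).mpr ?_, rfl⟩
  set g := Polynomial.aeval (R := ℂ) (formalOp : Module.End ℂ (PowerSeries ℂ)) (charPoly r a) f
    with hg
  -- The recurrence says nothing for j ≤ r; the finite sum dominates those coefficients.
  refine ⟨C + ∑ i ∈ range (r + 1), ‖PowerSeries.coeff i g‖ / M ^ i, M, by positivity, hM,
    fun j => ?_⟩
  rw [add_mul]
  rcases le_or_gt j r with hj | hj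
  · have h1 : ‖PowerSeries.coeff j g‖ / M ^ j ≤
        ∑ i ∈ range (r + 1), ‖PowerSeries.coeff i g‖ / M ^ i :=
      Finset.single_le_sum (f := fun i => ‖PowerSeries.coeff i g‖ / M ^ i)
        (fun i _ => by positivity) (mem_range.mpr (by omega))
    rw [div_le_iff₀ (by positivity)] at h1
    have : 0 ≤ C * M ^ j := by positivity
    linarith
  · have h1 := h j hj
    have h2 := congrArg (PowerSeries.coeff j) (borel_aeval (charPoly r a) f)
    rw [← hg, coeff_charPoly_mul _ _ _ _ hj] at h2
    simp only [coeff_borel] at h2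
    have hj0 : (0 : ℝ) < j.factorial := by exact_mod_cast j.factorial_pos
    rw [← h2, norm_div, Complex.norm_natCast, div_le_div_iff_of_pos_right hj0] at h1
    have : 0 ≤ (∑ i ∈ range (r + 1), ‖PowerSeries.coeff i g‖ / M ^ i) * M ^ j := by positivity
    linarith

/-! ### Sectors as half-strips in the coordinate log z -/

lemma sector_eq_reProdIm {d θ ρ : ℝ} (hρ : 0 < ρ) :
    sector d θ ρ =
      Set.Iio (Real.log ρ) ×ℂ Set.Ioo (d - Real.pi * θ / 2) (d + Real.pi * θ / 2) := by
  ext w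
  rw [Complex.mem_reProdIm, Set.mem_Iio, Set.mem_Ioo, Real.lt_log_iff_exp_lt hρ]
  simp only [sector, Set.mem_ofPred_eq, abs_lt]
  constructor
  · rintro ⟨⟨h1, h2⟩, h3⟩
    exact ⟨h3, by linarith, by linarith⟩
  · rintro ⟨h3, h1, h2⟩
    exact ⟨⟨by linarith, by linarith⟩, h3⟩

lemma isOpen_sector (d θ ρ : ℝ) : IsOpen (sector d θ ρ) := by
  have h1 : Continuous fun w : ℂ => |w.im - d| := by fun_prop
  have h2 : Continuous fun w : ℂ => Real.exp w.re := by fun_prop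
  exact (isOpen_lt h1 continuous_const).inter (isOpen_lt h2 continuous_const)

lemma convex_sector {d θ ρ : ℝ} (hρ : 0 < ρ) : Convex ℝ (sector d θ ρ) := by
  rw [sector_eq_reProdIm hρ]
  exact ((convex_Iio _).is_linear_preimage Complex.reLm.isLinear).inter
    ((convex_Ioo _ _).is_linear_preimage Complex.imLm.isLinear)

lemma sector_mono {d θ θ' ρ ρ' : ℝ} (hθ : θ' ≤ θ) (hρ : ρ' ≤ ρ) :
    sector d θ' ρ' ⊆ sector d θ ρ := fun w hw =>
  ⟨hw.1.trans_le (by have := Real.pi_pos; gcongr), hw.2.trans_le hρ⟩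

lemma closure_sector {d θ ρ : ℝ} (hθ : 0 < θ) (hρ : 0 < ρ) :
    closure (sector d θ ρ) = {w | |w.im - d| ≤ Real.pi * θ / 2 ∧ Real.exp w.re ≤ ρ} := by
  have hπ := Real.pi_pos
  have h0 : 0 < Real.pi * θ / 2 := by positivity
  rw [sector_eq_reProdIm hρ, Complex.closure_reProdIm, closure_Iio, closure_Ioo (by linarith)]
  ext w
  rw [Complex.mem_reProdIm, Set.mem_Iic, Set.mem_Icc, Real.le_log_iff_exp_le hρ]
  simp only [Set.mem_ofPred_eq, abs_le]
  constructor
  · rintro ⟨h3, h1, h2⟩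
    exact ⟨⟨by linarith, by linarith⟩, h3⟩
  · rintro ⟨⟨h1, h2⟩, h3⟩
    exact ⟨h3, by linarith, by linarith⟩

lemma closure_sector_subset_iff {d θ ρ d' θ' ρ' : ℝ} (hθ : 0 < θ') (hρ : 0 < ρ') :
    closure (sector d' θ' ρ') ⊆ sector d θ ρ ↔
      ρ' < ρ ∧ |d' - d| + Real.pi * θ' / 2 < Real.pi * θ / 2 := by
  have h0 : 0 < Real.pi * θ' / 2 := by have := Real.pi_pos; positivity
  rw [closure_sector hθ hρ]
  constructor
  · intro h
    -- The two corners on the outer arc of the closed sector already force both strict inequalities.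
    have h1 : ((Real.log ρ' : ℂ) + ((d' + Real.pi * θ' / 2 : ℝ) : ℂ) * Complex.I) ∈
        sector d θ ρ := h (by simp [abs_of_pos h0, Real.exp_log hρ])
    have h2 : ((Real.log ρ' : ℂ) + ((d' - Real.pi * θ' / 2 : ℝ) : ℂ) * Complex.I) ∈
        sector d θ ρ := h (by simp [abs_of_pos h0, Real.exp_log hρ])
    simp only [sector, Set.mem_ofPred_eq, Complex.add_im, Complex.ofReal_im, Complex.re_ofReal_mul,
      Complex.im_ofReal_mul, Complex.I_im, Complex.I_re, Complex.add_re, Complex.ofReal_re,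
      mul_zero, mul_one, zero_add, add_zero, Real.exp_log hρ, abs_lt] at h1 h2
    refine ⟨h1.2, ?_⟩
    rcases abs_cases (d' - d) with h3 | h3 <;> linarith [h1.1.1, h1.1.2, h2.1.1, h2.1.2]
  · rintro ⟨h1, h2⟩ w ⟨hw1, hw2⟩
    refine ⟨?_, hw2.trans_lt h1⟩
    calc |w.im - d| = |(w.im - d') + (d' - d)| := by ring_nf
      _ ≤ |w.im - d'| + |d' - d| := abs_add_le _ _
      _ < _ := by linarith

/-- A proper subsector can be thickened to a proper subsector by a fixed amount. -/
lemma exists_thickening {d θ ρ d' θ' ρ' : ℝ} (hθ : 0 < θ') (hρ : 0 < ρ')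
    (h : closure (sector d' θ' ρ') ⊆ sector d θ ρ) :
    ∃ δ θ'' ρ'' : ℝ, 0 < δ ∧ 0 < θ'' ∧ 0 < ρ'' ∧ closure (sector d' θ'' ρ'') ⊆ sector d θ ρ ∧
      ∀ w ∈ sector d' θ' ρ', Metric.closedBall w δ ⊆ sector d' θ'' ρ'' := by
  obtain ⟨h1, h2⟩ := (closure_sector_subset_iff hθ hρ).mp h
  have hπ := Real.pi_pos
  -- The half-opening and the logarithm of the radius both grow by 2δ, which must stay below the
  -- available slack.
  obtain ⟨δ, hδ, hδ1, hδ2⟩ : ∃ δ > 0, 2 * δ < Real.pi * θ / 2 - Real.pi * θ' / 2 - |d' - d| ∧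
      2 * δ < Real.log ρ - Real.log ρ' := by
    have h3 := Real.log_lt_log hρ h1
    refine ⟨min (Real.pi * θ / 2 - Real.pi * θ' / 2 - |d' - d|) (Real.log ρ - Real.log ρ') / 4,
      ?_, ?_, ?_⟩
    · have := lt_min (show 0 < Real.pi * θ / 2 - Real.pi * θ' / 2 - |d' - d| by linarith)
        (show 0 < Real.log ρ - Real.log ρ' by linarith)
      positivity
    · have := min_le_left (Real.pi * θ / 2 - Real.pi * θ' / 2 - |d' - d|)
        (Real.log ρ - Real.log ρ')
      linarith
    · have := min_le_right (Real.pi * θ / 2 - Real.pi * θ' / 2 - |d' - d|)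
        (Real.log ρ - Real.log ρ')
      linarith
  have h4 : Real.pi * (θ' + 4 * δ / Real.pi) / 2 = Real.pi * θ' / 2 + 2 * δ := by
    field_simp; ring
  refine ⟨δ, θ' + 4 * δ / Real.pi, ρ' * Real.exp (2 * δ), hδ, by positivity, by positivity, ?_, ?_⟩
  · rw [closure_sector_subset_iff (by positivity) (by positivity), h4]
    refine ⟨?_, by linarith⟩
    rw [← Real.exp_log hρ, ← Real.exp_add, ← Real.lt_log_iff_exp_lt (hρ.trans h1)]
    linarith
  · intro w hw z hz
    rw [Metric.mem_closedBall, dist_eq_norm] at hz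
    have hre := (abs_le.mp ((Complex.abs_re_le_norm (z - w)).trans hz)).2
    have him := abs_le.mp ((Complex.abs_im_le_norm (z - w)).trans hz)
    have hw1 := abs_lt.mp hw.1
    rw [Complex.sub_re] at hre
    rw [Complex.sub_im] at him
    refine ⟨?_, ?_⟩
    · rw [h4, abs_lt]; constructor <;> linarith
    · calc Real.exp z.re ≤ Real.exp (w.re + δ) := Real.exp_le_exp.mpr (by linarith)
        _ = Real.exp w.re * Real.exp δ := Real.exp_add _ _
        _ < ρ' * Real.exp (2 * δ) := by
          have := hw.2
          gcongr
          linarith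

/-! ### Gevrey expansions under the differential operator -/

lemma analyticOp_eq (F : ℂ → ℂ) (w : ℂ) :
    analyticOp F w = Complex.exp w * (deriv F w + F w) := by
  have := Complex.exp_ne_zero w
  simp only [analyticOp, dz]
  field_simp

lemma differentiableOn_analyticOp {d θ ρ : ℝ} {F : ℂ → ℂ}
    (h : DifferentiableOn ℂ F (sector d θ ρ)) :
    DifferentiableOn ℂ (analyticOp F) (sector d θ ρ) := by
  have : analyticOp F = fun w => Complex.exp w * (deriv F w + F w) := funext (analyticOp_eq F)
  rw [this]
  exact Complex.differentiable_exp.differentiableOn.mul ((h.deriv (isOpen_sector _ _ _)).add h)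

lemma deriv_exp_pow_sum (f : PowerSeries ℂ) (N : ℕ) (w : ℂ) :
    HasDerivAt (fun w => ∑ p ∈ range N, PowerSeries.coeff p f * Complex.exp w ^ p)
      (∑ p ∈ range N, (p : ℂ) * PowerSeries.coeff p f * Complex.exp w ^ p) w := by
  apply HasDerivAt.fun_sum
  intro p _
  have h := ((Complex.hasDerivAt_exp w).fun_pow p).const_mul (PowerSeries.coeff p f)
  refine h.congr_deriv ?_
  rcases p with _ | p
  · simp
  · simp only [Nat.add_sub_cancel, pow_succ]; ring

/-- In w = log z the operator is F ↦ e^w(F' + F). Cauchy's estimate on discs of one fixed radius δ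
in w controls the derivative of each remainder without losing a factorial, and e^w raises the order
by one. -/
lemma HasGevreyOneExpansion.analyticOp {d θ ρ : ℝ} {F : ℂ → ℂ} {f : PowerSeries ℂ}
    (hF : DifferentiableOn ℂ F (sector d θ ρ)) (h : HasGevreyOneExpansion d θ ρ F f) :
    HasGevreyOneExpansion d θ ρ (analyticOp F) (formalOp f) := by
  intro d' θ' ρ' hθ' hρ' hsub
  obtain ⟨δ, θ'', ρ'', hδ, hθ'', hρ'', hsub'', hball⟩ := exists_thickening hθ' hρ' hsub
  obtain ⟨C, A, hC, hA, hb⟩ := h d' θ'' ρ'' hθ'' hρ'' hsub''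
  have hS : sector d' θ'' ρ'' ⊆ sector d θ ρ := subset_closure.trans hsub''
  have hRd : ∀ N : ℕ, DifferentiableOn ℂ
      (fun w => F w - ∑ p ∈ range N, PowerSeries.coeff p f * Complex.exp w ^ p)
      (sector d θ ρ) := fun N =>
    hF.sub fun w _ => (deriv_exp_pow_sum f N w).differentiableAt.differentiableWithinAt
  have hstep : ∀ N : ℕ, ∀ w ∈ sector d' θ' ρ',
      ‖OneSummability.analyticOp F w -
        ∑ p ∈ range (N + 1), PowerSeries.coeff p (formalOp f) * Complex.exp w ^ p‖ ≤
        (C / δ + C) * (A * Real.exp δ) ^ N * N.factorial * ‖Complex.exp w‖ ^ (N + 1) := by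
    intro N w hw
    have hwS : w ∈ sector d θ ρ := subset_closure.trans hsub hw
    set R : ℂ → ℂ := fun w => F w - ∑ p ∈ range N, PowerSeries.coeff p f * Complex.exp w ^ p
      with hR
    have hFd : DifferentiableAt ℂ F w :=
      hF.differentiableAt ((isOpen_sector _ _ _).mem_nhds hwS)
    have hder : deriv R w =
        deriv F w - ∑ p ∈ range N, (p : ℂ) * PowerSeries.coeff p f * Complex.exp w ^ p :=
      (hFd.hasDerivAt.sub (deriv_exp_pow_sum f N w)).deriv
    -- Remainders correspond exactly: order N + 1 for the image comes from order N for `F`, since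
    -- `formalOp` shifts the coefficients and leaves no constant term.
    have hkey : OneSummability.analyticOp F w -
        ∑ p ∈ range (N + 1), PowerSeries.coeff p (formalOp f) * Complex.exp w ^ p =
        Complex.exp w * (deriv R w + R w) := by
      rw [Finset.sum_range_succ', coeff_zero_formalOp, analyticOp_eq, hder, hR]
      have : ∑ p ∈ range N, PowerSeries.coeff (p + 1) (formalOp f) * Complex.exp w ^ (p + 1) =
          Complex.exp w * (∑ p ∈ range N, (p : ℂ) * PowerSeries.coeff p f * Complex.exp w ^ p +
            ∑ p ∈ range N, PowerSeries.coeff p f * Complex.exp w ^ p) := by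
        rw [← Finset.sum_add_distrib, Finset.mul_sum]
        refine Finset.sum_congr rfl fun p _ => ?_
        rw [coeff_succ_formalOp]; ring
      rw [this]; ring
    have hRw : ‖R w‖ ≤ C * (A * Real.exp δ) ^ N * N.factorial * ‖Complex.exp w‖ ^ N := by
      refine (hb N w (hball w hw (Metric.mem_closedBall_self hδ.le))).trans ?_
      gcongr
      exact le_mul_of_one_le_right hA.le (Real.one_le_exp hδ.le)
    have hR' : ‖deriv R w‖ ≤
        C * (A * Real.exp δ) ^ N * N.factorial * ‖Complex.exp w‖ ^ N / δ := by
      apply Complex.norm_deriv_le_of_forall_mem_sphere_norm_le hδ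
      · apply DifferentiableOn.diffContOnCl
        exact (hRd N).mono (Metric.closure_ball_subset_closedBall.trans ((hball w hw).trans hS))
      · intro z hz
        refine (hb N z (hball w hw (Metric.sphere_subset_closedBall hz))).trans ?_
        have hz' : ‖z - w‖ = δ := by rw [← dist_eq_norm]; exact hz
        have hre := (abs_le.mp ((Complex.abs_re_le_norm (z - w)).trans hz'.le)).2
        rw [Complex.sub_re] at hre
        -- A move by δ in w multiplies |z| by at most e^δ; the N-th power of this goes into the new
        -- geometric constant.
        have : ‖Complex.exp z‖ ≤ Real.exp δ * ‖Complex.exp w‖ := by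
          rw [Complex.norm_exp, Complex.norm_exp, ← Real.exp_add]
          exact Real.exp_le_exp.mpr (by linarith)
        calc C * A ^ N * N.factorial * ‖Complex.exp z‖ ^ N
            ≤ C * A ^ N * N.factorial * (Real.exp δ * ‖Complex.exp w‖) ^ N := by gcongr
          _ = _ := by rw [mul_pow, mul_pow]; ring
    rw [hkey, norm_mul]
    calc ‖Complex.exp w‖ * ‖deriv R w + R w‖
        ≤ ‖Complex.exp w‖ * (C * (A * Real.exp δ) ^ N * N.factorial * ‖Complex.exp w‖ ^ N / δ +
          C * (A * Real.exp δ) ^ N * N.factorial * ‖Complex.exp w‖ ^ N) := by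
          gcongr; exact (norm_add_le _ _).trans (add_le_add hR' hRw)
      _ = _ := by rw [pow_succ]; field_simp
  -- For order 0 the bound from `hstep` has a surplus factor |e^w| ≤ ρ', absorbed by `ρ' + 1`. The
  -- added 1 in the base makes it at least 1, so the exponent may rise from N to N + 1.
  refine ⟨(C / δ + C) * (ρ' + 1), A * Real.exp δ + 1, by positivity, by positivity,
    fun N w hw => ?_⟩
  have hexp : ‖Complex.exp w‖ ≤ ρ' := by rw [Complex.norm_exp]; exact hw.2.le
  rcases N with _ | N
  · have := hstep 0 w hw
    simp only [zero_add, range_one, sum_singleton, coeff_zero_formalOp, sub_zero,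
      pow_zero, mul_one, Nat.factorial_zero, Nat.cast_one, pow_one, range_zero, sum_empty] at this ⊢
    refine this.trans ?_
    gcongr
    linarith
  · refine (hstep N w hw).trans ?_
    have h1 : (A * Real.exp δ) ^ N ≤ (A * Real.exp δ + 1) ^ (N + 1) := by
      calc (A * Real.exp δ) ^ N ≤ (A * Real.exp δ + 1) ^ N := by gcongr; linarith
        _ ≤ _ := pow_le_pow_right₀ (by have := mul_pos hA (Real.exp_pos δ); linarith) (by omega)
    have h2 : (N.factorial : ℝ) ≤ ((N + 1).factorial : ℝ) := by
      exact_mod_cast Nat.factorial_le (by omega)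
    have h3 : C / δ + C ≤ (C / δ + C) * (ρ' + 1) :=
      le_mul_of_one_le_right (by positivity) (by linarith)
    gcongr

lemma HasGevreyOneExpansion.zero (d θ ρ : ℝ) : HasGevreyOneExpansion d θ ρ (fun _ => 0) 0 := by
  intro d' θ' ρ' _ _ _
  refine ⟨1, 1, one_pos, one_pos, fun N w _ => ?_⟩
  simp only [map_zero, zero_mul, Finset.sum_const_zero, sub_zero, norm_zero]
  positivity

lemma HasGevreyOneExpansion.const_mul {d θ ρ : ℝ} {F : ℂ → ℂ} {f : PowerSeries ℂ}
    (h : HasGevreyOneExpansion d θ ρ F f) (c : ℂ) :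
    HasGevreyOneExpansion d θ ρ (fun w => c * F w) (c • f) := by
  intro d' θ' ρ' hθ' hρ' hsub
  obtain ⟨C, A, hC, hA, hb⟩ := h d' θ' ρ' hθ' hρ' hsub
  refine ⟨(‖c‖ + 1) * C, A, by positivity, hA, fun N w hw => ?_⟩
  have : c * F w - ∑ p ∈ range N, PowerSeries.coeff p (c • f) * Complex.exp w ^ p =
      c * (F w - ∑ p ∈ range N, PowerSeries.coeff p f * Complex.exp w ^ p) := by
    rw [mul_sub, Finset.mul_sum]
    simp [mul_assoc]
  rw [this, norm_mul]
  calc ‖c‖ * _ ≤ (‖c‖ + 1) * (C * A ^ N * N.factorial * ‖Complex.exp w‖ ^ N) := by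
        gcongr
        · linarith
        · exact hb N w hw
    _ = _ := by ring

lemma HasGevreyOneExpansion.add {d θ ρ : ℝ} {F G : ℂ → ℂ} {f g : PowerSeries ℂ}
    (hF : HasGevreyOneExpansion d θ ρ F f) (hG : HasGevreyOneExpansion d θ ρ G g) :
    HasGevreyOneExpansion d θ ρ (fun w => F w + G w) (f + g) := by
  intro d' θ' ρ' hθ' hρ' hsub
  obtain ⟨C, A, hC, hA, hb⟩ := hF d' θ' ρ' hθ' hρ' hsub
  obtain ⟨C', A', hC', hA', hb'⟩ := hG d' θ' ρ' hθ' hρ' hsub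
  refine ⟨C + C', A + A', by positivity, by positivity, fun N w hw => ?_⟩
  have : F w + G w - ∑ p ∈ range N, PowerSeries.coeff p (f + g) * Complex.exp w ^ p =
      (F w - ∑ p ∈ range N, PowerSeries.coeff p f * Complex.exp w ^ p) +
      (G w - ∑ p ∈ range N, PowerSeries.coeff p g * Complex.exp w ^ p) := by
    simp only [map_add, add_mul, Finset.sum_add_distrib]; ring
  rw [this]
  calc _ ≤ C * A ^ N * N.factorial * ‖Complex.exp w‖ ^ N +
        C' * A' ^ N * N.factorial * ‖Complex.exp w‖ ^ N :=
      (norm_add_le _ _).trans (add_le_add (hb N w hw) (hb' N w hw))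
    _ ≤ C * (A + A') ^ N * N.factorial * ‖Complex.exp w‖ ^ N +
        C' * (A + A') ^ N * N.factorial * ‖Complex.exp w‖ ^ N := by
      gcongr <;> linarith
    _ = _ := by ring

lemma HasGevreyOneExpansion.sub {d θ ρ : ℝ} {F G : ℂ → ℂ} {f g : PowerSeries ℂ}
    (hF : HasGevreyOneExpansion d θ ρ F f) (hG : HasGevreyOneExpansion d θ ρ G g) :
    HasGevreyOneExpansion d θ ρ (fun w => F w - G w) (f - g) := by
  have := hF.add (hG.const_mul (-1))
  simpa [sub_eq_add_neg] using this

lemma HasGevreyOneExpansion.sum {ι : Type*} (s : Finset ι) {d θ ρ : ℝ} {F : ι → ℂ → ℂ}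
    {f : ι → PowerSeries ℂ} (h : ∀ i ∈ s, HasGevreyOneExpansion d θ ρ (F i) (f i)) :
    HasGevreyOneExpansion d θ ρ (fun w => ∑ i ∈ s, F i w) (∑ i ∈ s, f i) := by
  classical
  induction s using Finset.induction_on with
  | empty => simpa using HasGevreyOneExpansion.zero d θ ρ
  | insert i s hi ih =>
    simp only [Finset.sum_insert hi]
    exact (h i (mem_insert_self _ _)).add (ih fun j hj => h j (mem_insert_of_mem hj))

lemma HasGevreyOneExpansion.mono {d θ ρ ρ' : ℝ} {F : ℂ → ℂ} {f : PowerSeries ℂ}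
    (h : HasGevreyOneExpansion d θ ρ F f) (hρ : ρ' ≤ ρ) : HasGevreyOneExpansion d θ ρ' F f :=
  fun d' θ'' ρ'' h1 h2 h3 => h d' θ'' ρ'' h1 h2 (h3.trans (sector_mono le_rfl hρ))

lemma iterate_analyticOp {d θ ρ : ℝ} {F : ℂ → ℂ} {f : PowerSeries ℂ}
    (hF : DifferentiableOn ℂ F (sector d θ ρ)) (h : HasGevreyOneExpansion d θ ρ F f) (m : ℕ) :
    DifferentiableOn ℂ (analyticOp^[m] F) (sector d θ ρ) ∧
      HasGevreyOneExpansion d θ ρ (analyticOp^[m] F)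
        (((formalOp : Module.End ℂ (PowerSeries ℂ)) ^ m) f) := by
  induction m with
  | zero => exact ⟨hF, h⟩
  | succ m ih =>
    rw [Function.iterate_succ_apply', pow_succ', Module.End.mul_apply]
    exact ⟨differentiableOn_analyticOp ih.1, ih.2.analyticOp ih.1⟩

lemma differentiableOn_polyOp {d θ ρ : ℝ} {F : ℂ → ℂ} {f : PowerSeries ℂ}
    (hF : DifferentiableOn ℂ F (sector d θ ρ)) (h : HasGevreyOneExpansion d θ ρ F f)
    (P : Polynomial ℂ) : DifferentiableOn ℂ (polyOp P F) (sector d θ ρ) := by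
  unfold polyOp
  simp only [Polynomial.sum_def]
  exact DifferentiableOn.fun_sum fun m _ => (iterate_analyticOp hF h m).1.const_mul _

lemma HasGevreyOneExpansion.polyOp {d θ ρ : ℝ} {F : ℂ → ℂ} {f : PowerSeries ℂ}
    (hF : DifferentiableOn ℂ F (sector d θ ρ)) (h : HasGevreyOneExpansion d θ ρ F f)
    (P : Polynomial ℂ) : HasGevreyOneExpansion d θ ρ (polyOp P F)
      (Polynomial.aeval (R := ℂ) (formalOp : Module.End ℂ (PowerSeries ℂ)) P f) := by
  unfold OneSummability.polyOp
  simp only [Polynomial.sum_def]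
  rw [aeval_formalOp_apply]
  exact HasGevreyOneExpansion.sum _ fun m _ => (iterate_analyticOp hF h m).2.const_mul _

/-! ### Expansions of convergent series and uniqueness of expansions -/

/-- Remainder estimate for a power series with geometrically bounded coefficients. -/
lemma hasSum_remainder_le {a : ℕ → ℂ} {B R : ℝ} (hR : 0 ≤ R) (ha : ∀ p, ‖a p‖ ≤ B * R ^ p)
    {x s : ℂ} {q : ℝ} (hq : R * ‖x‖ ≤ q) (hq1 : q < 1) (hs : HasSum (fun p => a p * x ^ p) s)
    (N : ℕ) : ‖s - ∑ p ∈ range N, a p * x ^ p‖ ≤ B / (1 - q) * (R * ‖x‖) ^ N := by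
  have hB : 0 ≤ B := by have := (norm_nonneg _).trans (ha 0); simpa using this
  have h0 : 0 ≤ R * ‖x‖ := by positivity
  have h1 := (hasSum_nat_add_iff' (f := fun p => a p * x ^ p) N).mpr hs
  have h2 := (hasSum_geometric_of_lt_one h0 (hq.trans_lt hq1)).mul_left (B * (R * ‖x‖) ^ N)
  refine (h1.norm_le_of_bounded h2 fun p => ?_).trans ?_
  · rw [norm_mul, norm_pow]
    calc ‖a (p + N)‖ * ‖x‖ ^ (p + N) ≤ B * R ^ (p + N) * ‖x‖ ^ (p + N) := by
          gcongr; exact ha _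
      _ = _ := by rw [mul_pow, mul_pow, pow_add, pow_add]; ring
  · rw [mul_comm, ← mul_assoc, mul_comm _ B, ← div_eq_mul_inv]
    have : 0 < 1 - q := by linarith
    gcongr

/-- The sum of a convergent power series has that series as its expansion. -/
lemma hasGevreyOneExpansion_of_hasSum {d θ ρ : ℝ} {g : PowerSeries ℂ} {G : ℂ → ℂ}
    (hρ : ENNReal.ofReal ρ ≤ convRadius g)
    (h : ∀ w ∈ sector d θ ρ,
      HasSum (fun n : ℕ => PowerSeries.coeff n g * Complex.exp w ^ n) (G w)) :
    HasGevreyOneExpansion d θ ρ G g := by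
  intro d' θ' ρ' hθ' hρ' hsub
  have h1 := ((closure_sector_subset_iff hθ' hρ').mp hsub).1
  obtain ⟨r, hr1, hr2⟩ := exists_between h1
  have hr0 : 0 < r := hρ'.trans hr1
  obtain ⟨B, hB, hb⟩ := exists_norm_coeff_le_of_lt_convRadius hr0
    (((ENNReal.ofReal_lt_ofReal_iff (hr0.trans hr2)).mpr hr2).trans_le hρ)
  have hq : ρ' / r < 1 := (div_lt_one hr0).mpr hr1
  have hq' : 0 < 1 - ρ' / r := by linarith
  refine ⟨B / (1 - ρ' / r), r⁻¹, by positivity, by positivity, fun N w hw => ?_⟩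
  have hexp : ‖Complex.exp w‖ ≤ ρ' := by rw [Complex.norm_exp]; exact hw.2.le
  have h2 := hasSum_remainder_le (q := ρ' / r) (by positivity) hb
    (by rw [div_eq_inv_mul]; gcongr) hq (h w (subset_closure.trans hsub hw)) N
  refine h2.trans ?_
  have : (1 : ℝ) ≤ N.factorial := by exact_mod_cast N.factorial_pos
  rw [mul_pow, ← mul_assoc]
  exact mul_le_mul_of_nonneg_right (le_mul_of_one_le_right (by positivity) this) (by positivity)

/-- A function has at most one asymptotic expansion. -/
lemma HasGevreyOneExpansion.eq_zero {d θ ρ : ℝ} (hθ : 0 < θ) (hρ : 0 < ρ) {f : PowerSeries ℂ}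
    (h : HasGevreyOneExpansion d θ ρ (fun _ => 0) f) : f = 0 := by
  have hπ := Real.pi_pos
  obtain ⟨C, A, hC, hA, hb⟩ := h d (θ / 2) (ρ / 2) (by positivity) (by positivity)
    ((closure_sector_subset_iff (by positivity) (by positivity)).mpr
      ⟨by linarith, by rw [sub_self, abs_zero, zero_add]; gcongr; linarith⟩)
  ext n
  induction n using Nat.strong_induction_on with
  | _ n ih =>
    -- The lower coefficients vanish by induction, so the estimate of order n + 1 bounds |f_n|tⁿ by
    -- a constant times tⁿ⁺¹; then t → 0.
    have key : ∀ t ∈ Set.Ioo (0 : ℝ) (ρ / 2),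
        ‖PowerSeries.coeff n f‖ ≤ C * A ^ (n + 1) * (n + 1).factorial * t := by
      rintro t ⟨ht0, ht⟩
      have hw : ((Real.log t : ℂ) + (d : ℂ) * Complex.I) ∈ sector d (θ / 2) (ρ / 2) := by
        refine ⟨?_, ?_⟩
        · simp only [Complex.add_im, Complex.ofReal_im, Complex.im_ofReal_mul, Complex.I_im,
            mul_one, zero_add, sub_self, abs_zero]
          positivity
        · simpa [Real.exp_log ht0] using ht
      have h1 := hb (n + 1) _ hw
      have h2 : ‖Complex.exp ((Real.log t : ℂ) + (d : ℂ) * Complex.I)‖ = t := by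
        rw [Complex.norm_exp]; simp [Real.exp_log ht0]
      rw [Finset.sum_range_succ, Finset.sum_eq_zero, zero_add, zero_sub, norm_neg, norm_mul,
        norm_pow, h2] at h1
      · rw [pow_succ t, mul_comm (t ^ n) t, ← mul_assoc] at h1
        exact le_of_mul_le_mul_right h1 (by positivity)
      · intro p hp
        rw [ih p (mem_range.mp hp)]; simp
    have hlim : Filter.Tendsto (fun t : ℝ => C * A ^ (n + 1) * (n + 1).factorial * t)
        (nhdsWithin 0 (Set.Ioi 0)) (nhds 0) := by
      have : Continuous fun t : ℝ => C * A ^ (n + 1) * (n + 1).factorial * t := by fun_prop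
      have h3 := (this.tendsto 0).mono_left (nhdsWithin_le_nhds (s := Set.Ioi 0))
      simpa using h3
    have h4 := ge_of_tendsto hlim (by
      filter_upwards [Ioo_mem_nhdsGT (show (0 : ℝ) < ρ / 2 by positivity)] with t ht
      exact key t ht)
    simpa using norm_le_zero_iff.mp h4

/-! ### Watson's lemma -/

/-- Null Gevrey estimates give exponential smallness. -/
lemma norm_le_exp_of_forall_le {y r C A : ℝ} (hr : 0 < r) (hA : 0 < A)
    (h : ∀ N : ℕ, y ≤ C * A ^ N * N.factorial * r ^ N) :
    y ≤ 2 * C * Real.exp (-(1 / (2 * A) * r⁻¹)) := by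
  -- Weighting the N-th estimate by (2Ar)⁻ᴺ/N! and summing gives an exponential on the left and a
  -- geometric series on the right.
  have h1 := (NormedSpace.expSeries_div_hasSum_exp (1 / (2 * A) * r⁻¹)).mul_left y
  rw [← Real.exp_eq_exp_ℝ] at h1
  have h2 := hasSum_geometric_two.mul_left C
  have h3 := hasSum_le (fun N => ?_) h1 h2
  · rw [Real.exp_neg, ← div_eq_mul_inv, le_div_iff₀ (Real.exp_pos _)]
    linarith
  · have hN : (0 : ℝ) < N.factorial := by exact_mod_cast N.factorial_pos
    have h4 : y / (A ^ N * N.factorial * r ^ N) ≤ C := by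
      rw [div_le_iff₀ (by positivity)]
      exact (h N).trans_eq (by ring)
    calc y * ((1 / (2 * A) * r⁻¹) ^ N / N.factorial)
        = y / (A ^ N * N.factorial * r ^ N) * (1 / 2) ^ N := by
          rw [mul_pow, div_pow, div_pow, mul_pow, inv_pow, one_pow]; field_simp
      _ ≤ C * (1 / 2) ^ N := by gcongr

/-- This is where an opening larger than π matters: for θ > 1 the power x^θ outgrows every nx. -/
lemma tendsto_exp_pow_mul_exp_neg_rpow {θ c : ℝ} (hθ : 1 < θ) (hc : 0 < c) (n : ℕ) :
    Filter.Tendsto (fun x : ℝ => Real.exp x ^ n * Real.exp (-(c * x ^ θ))) Filter.atTop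
      (nhds 0) := by
  have h1 : Filter.Tendsto (fun x : ℝ => x * (c * x ^ (θ - 1) - n)) Filter.atTop Filter.atTop := by
    refine Filter.tendsto_id.atTop_mul_atTop₀ ?_
    exact Filter.tendsto_atTop_add_const_right _ _
      ((tendsto_rpow_atTop (by linarith)).const_mul_atTop hc)
  have h2 := Real.tendsto_exp_neg_atTop_nhds_zero.comp h1
  refine h2.congr' ?_
  filter_upwards [Filter.eventually_gt_atTop 0] with x hx
  have : x ^ θ = x * x ^ (θ - 1) := by
    rw [← Real.rpow_one_add' hx.le (by linarith)]; congr 1; ring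
  rw [Function.comp_apply, ← Real.exp_nat_mul, ← Real.exp_add, this]
  congr 1; ring

/-- An exponentially small holomorphic function on a sector of opening larger than `π` vanishes. -/
lemma eq_zero_of_exp_small {d θ ρ C c : ℝ} (hθ : 1 < θ) (hρ : 0 < ρ) (hC : 0 < C) (hc : 0 < c)
    {G : ℂ → ℂ} (hd : DifferentiableOn ℂ G (sector d θ ρ))
    (h : ∀ w ∈ sector d θ ρ, ‖G w‖ ≤ C * Real.exp (-(c * Real.exp (-w.re)))) :
    Set.EqOn G 0 (sector d θ ρ) := by
  have hθ0 : 0 < θ := by linarith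
  have hπ := Real.pi_pos
  -- Chosen so that R^(-θ) = ρ/e, which keeps the image of the half-plane below radius ρ.
  set R : ℝ := Real.exp ((1 - Real.log ρ) / θ) with hR
  have hR0 : 0 < R := Real.exp_pos _
  -- In the variable z this is z = e^(id)(v + R)^(-θ), from the closed right half-plane into the
  -- sector. The bound exp(-c/|z|) becomes exp(-c|v + R|^θ), a superexponential decay.
  set W : ℂ → ℂ := fun v => (d : ℂ) * Complex.I - θ * Complex.log (v + R) with hW
  have hWre : ∀ v, (W v).re = -(θ * Real.log ‖v + R‖) := fun v => by
    simp [hW, Complex.log_re]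
  have hWim : ∀ v, (W v).im = d - θ * (v + R).arg := fun v => by
    simp [hW, Complex.log_im]
  have hvR : ∀ v : ℂ, 0 ≤ v.re → R ≤ (v + R).re := fun v hv => by simpa using hv
  have hWmem : ∀ v : ℂ, 0 ≤ v.re → W v ∈ sector d θ ρ := by
    intro v hv
    have h1 := hvR v hv
    have h2 : R ≤ ‖v + R‖ := h1.trans ((le_abs_self _).trans (Complex.abs_re_le_norm _))
    refine ⟨?_, ?_⟩
    · rw [hWim, sub_sub_cancel_left, abs_neg, abs_mul, abs_of_pos hθ0]
      have h3 : |(v + R).arg| < Real.pi / 2 :=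
        Complex.abs_arg_lt_pi_div_two_iff.mpr (Or.inl (hR0.trans_le h1))
      nlinarith
    · rw [hWre, ← Real.lt_log_iff_exp_lt hρ]
      have h3 := Real.log_le_log hR0 h2
      rw [hR, Real.log_exp, div_le_iff₀ hθ0] at h3
      linarith
  have hWd : ∀ v : ℂ, 0 ≤ v.re → DifferentiableAt ℂ W v := by
    intro v hv
    have h1 : v + R ∈ Complex.slitPlane := Or.inl (hR0.trans_le (hvR v hv))
    exact ((((differentiableAt_id).add_const _).clog h1).const_mul _).const_sub _
  have hf : Set.EqOn (fun v => G (W v)) 0 {z | 0 ≤ z.re} := by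
    have hb : ∀ v : ℂ, 0 ≤ v.re → ‖G (W v)‖ ≤ C := fun v hv => by
      refine (h _ (hWmem v hv)).trans (mul_le_of_le_one_right hC.le ?_)
      rw [Real.exp_le_one_iff]
      have := Real.exp_pos (-(W v).re)
      nlinarith
    apply PhragmenLindelof.eq_zero_on_right_half_plane_of_superexponential_decay
    · apply DifferentiableOn.diffContOnCl
      rw [Complex.closure_setOfPred_lt_re]
      intro v hv
      have := (hd.differentiableAt ((isOpen_sector _ _ _).mem_nhds (hWmem v hv))).comp v (hWd v hv)
      exact this.differentiableWithinAt
    · refine ⟨1, by norm_num, 0, Asymptotics.IsBigO.of_bound C ?_⟩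
      refine Filter.Eventually.filter_mono inf_le_right ?_
      rw [Filter.eventually_principal]
      intro v hv
      simpa using hb v (le_of_lt hv)
    · intro n
      have h1 := (tendsto_exp_pow_mul_exp_neg_rpow hθ hc n).const_mul C
      rw [mul_zero] at h1
      refine squeeze_zero' (Filter.Eventually.of_forall fun x => by positivity) ?_ h1
      filter_upwards [Filter.eventually_gt_atTop 0] with x hx
      have h2 := h _ (hWmem x (by simpa using hx.le))
      rw [mul_left_comm]
      refine mul_le_mul_of_nonneg_left (h2.trans ?_) (by positivity)
      have h3 : Real.exp (-(W x).re) = (x + R) ^ θ := by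
        rw [hWre, neg_neg, Real.rpow_def_of_pos (by positivity), mul_comm]
        congr 3
        rw [← Complex.ofReal_add, Complex.norm_real, Real.norm_of_nonneg (by positivity)]
      rw [h3]
      gcongr
      linarith
    · exact ⟨C, fun x => hb _ (by simp)⟩
  have hw0 : W 1 ∈ sector d θ ρ := hWmem 1 (by simp)
  -- The image of `W` need not be the whole sector. A local inverse `V` shows that it contains a
  -- neighbourhood of `W 1`, and the identity theorem does the rest.
  have hinv : ∀ᶠ w in nhds (W 1), G w = 0 := by
    set V : ℂ → ℂ := fun w => Complex.exp (((d : ℂ) * Complex.I - w) / θ) - R with hV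
    have hVc : Continuous V := by fun_prop
    have hV1 : V (W 1) = 1 := by
      have : ((d : ℂ) * Complex.I - W 1) / θ = Complex.log (1 + R) := by
        have : (θ : ℂ) ≠ 0 := by exact_mod_cast hθ0.ne'
        simp only [hW]; field_simp; ring
      simp only [hV]
      rw [this, Complex.exp_log, add_sub_cancel_right]
      intro h0
      have := congrArg Complex.re h0
      simp at this
      linarith
    have he : ∀ᶠ w in nhds (W 1), 0 < (V w).re :=
      (Complex.continuous_re.comp hVc).continuousAt.eventually (lt_mem_nhds (by
        change (0 : ℝ) < (V (W 1)).re; rw [hV1]; simp))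
    filter_upwards [he, (isOpen_sector d θ ρ).mem_nhds hw0] with w hw hws
    have h1 : W (V w) = w := by
      have h2 : |w.im - d| / θ < Real.pi / 2 := by
        rw [div_lt_iff₀ hθ0]; linarith [hws.1]
      have him : (((d : ℂ) * Complex.I - w) / θ).im = -((w.im - d) / θ) := by
        rw [Complex.div_ofReal_im]; simp; ring
      have h3 : |(((d : ℂ) * Complex.I - w) / θ).im| < Real.pi / 2 := by
        rw [him, abs_neg, abs_div, abs_of_pos hθ0]; exact h2
      rw [abs_lt] at h3
      have : (θ : ℂ) ≠ 0 := by exact_mod_cast hθ0.ne'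
      simp only [hW, hV, sub_add_cancel]
      rw [Complex.log_exp (by linarith) (by linarith)]
      field_simp; ring
    rw [← h1]
    exact hf (le_of_lt hw)
  exact (hd.analyticOnNhd (isOpen_sector _ _ _)).eqOn_zero_of_preconnected_of_eventuallyEq_zero
    (convex_sector hρ).isPreconnected hw0 hinv

/-- Watson's lemma. -/
lemma HasGevreyOneExpansion.eqOn_zero {d θ ρ : ℝ} (hθ : 1 < θ) {G : ℂ → ℂ}
    (hd : DifferentiableOn ℂ G (sector d θ ρ)) (h : HasGevreyOneExpansion d θ ρ G 0) :
    Set.EqOn G 0 (sector d θ ρ) := by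
  intro w hw
  have hπ := Real.pi_pos
  -- Constants are uniform only on proper subsectors; one is chosen that contains `w` and still has
  -- opening larger than π.
  obtain ⟨ρ', h1, h2⟩ := _root_.exists_between hw.2
  obtain ⟨θ', h3, h4⟩ : ∃ θ', max 1 (2 * |w.im - d| / Real.pi) < θ' ∧ θ' < θ := by
    apply _root_.exists_between
    rw [max_lt_iff]
    refine ⟨hθ, ?_⟩
    rw [div_lt_iff₀ hπ]
    linarith [hw.1]
  rw [max_lt_iff, div_lt_iff₀ hπ] at h3
  have hρ' : 0 < ρ' := (Real.exp_pos _).trans h1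
  have hsub : closure (sector d θ' ρ') ⊆ sector d θ ρ :=
    (closure_sector_subset_iff (by linarith) hρ').mpr
      ⟨h2, by rw [sub_self, abs_zero, zero_add]; gcongr⟩
  obtain ⟨C, A, hC, hA, hb⟩ := h d θ' ρ' (by linarith) hρ' hsub
  refine eq_zero_of_exp_small (C := 2 * C) (c := 1 / (2 * A)) h3.1 hρ' (by positivity)
    (by positivity) (hd.mono (subset_closure.trans hsub)) (fun z hz => ?_)
    (⟨by linarith [h3.2], h1⟩ : w ∈ sector d θ' ρ')
  rw [Real.exp_neg z.re, ← Complex.norm_exp]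
  refine norm_le_exp_of_forall_le (norm_pos_iff.mpr (Complex.exp_ne_zero z)) hA fun N => ?_
  simpa using hb N z hz

/-! ### From formal to actual solutions and back -/

/-- Every `1`-sum of a formal solution is an actual solution. -/
lemma isActualSolution_of_isOneSum {P : Polynomial ℂ} {g f : PowerSeries ℂ}
    (h : IsFormalSolution P g f) {d θ ρ : ℝ} {F : ℂ → ℂ} (hF : IsOneSum f d θ ρ F) :
    IsActualSolution P g d θ ρ F := by
  obtain ⟨hθ, hρ, hd, hG⟩ := hF
  intro w hw hwR
  have hsum : ∀ z : ℂ, ‖Complex.exp z‖ₑ < convRadius g →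
      Summable fun n : ℕ => PowerSeries.coeff n g * Complex.exp z ^ n := by
    intro z hz
    obtain ⟨r, hr1, hr2⟩ := ENNReal.lt_iff_exists_nnreal_btwn.mp hz
    have hzr : ‖Complex.exp z‖ < r := by
      rw [← ofReal_norm, ← ENNReal.ofReal_coe_nnreal] at hr1
      exact (ENNReal.ofReal_lt_ofReal_iff_of_nonneg (norm_nonneg _)).mp hr1
    have hr0 : (0 : ℝ) < r := (norm_nonneg _).trans_lt hzr
    obtain ⟨B, hB, hb⟩ := exists_norm_coeff_le_of_lt_convRadius hr0
      (by rwa [ENNReal.ofReal_coe_nnreal])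
    refine Summable.of_norm_bounded (g := fun n => B * (‖Complex.exp z‖ / r) ^ n)
      ((summable_geometric_of_lt_one (by positivity) ((div_lt_one hr0).mpr hzr)).mul_left B)
      fun n => ?_
    rw [norm_mul, norm_pow, div_eq_inv_mul, mul_pow, ← mul_assoc]
    gcongr
    exact hb n
  -- The radius is cut down to the disc of convergence of `g`, keeping `w` inside; the opening,
  -- needed for Watson's lemma, is untouched.
  obtain ⟨ρ', h1, h2, h3⟩ : ∃ ρ', Real.exp w.re < ρ' ∧ ρ' ≤ ρ ∧
      ENNReal.ofReal ρ' ≤ convRadius g := by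
    rw [← ofReal_norm, Complex.norm_exp] at hwR
    have hw2 : ENNReal.ofReal (Real.exp w.re) < ENNReal.ofReal ρ :=
      (ENNReal.ofReal_lt_ofReal_iff hρ).mpr hw.2
    obtain ⟨r, hr1, hr2⟩ := ENNReal.lt_iff_exists_nnreal_btwn.mp (lt_min hw2 hwR)
    rw [← ENNReal.ofReal_coe_nnreal] at hr1 hr2
    rw [lt_min_iff] at hr2
    exact ⟨r, (ENNReal.ofReal_lt_ofReal_iff_of_nonneg (Real.exp_pos _).le).mp hr1,
      ((ENNReal.ofReal_lt_ofReal_iff_of_nonneg r.2).mp hr2.1).le,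
      hr2.2.le⟩
  have hρ' : 0 < ρ' := (Real.exp_pos _).trans h1
  set S : ℂ → ℂ := fun z => ∑' n : ℕ, PowerSeries.coeff n g * Complex.exp z ^ n with hS
  have hmem : ∀ z ∈ sector d θ ρ', ‖Complex.exp z‖ₑ < convRadius g := by
    intro z hz
    refine lt_of_lt_of_le ?_ h3
    rw [← ofReal_norm, Complex.norm_exp]
    exact (ENNReal.ofReal_lt_ofReal_iff hρ').mpr hz.2
  have hSd : DifferentiableOn ℂ S (sector d θ ρ') := by
    intro z hz
    obtain ⟨s, hs1, hs2⟩ := _root_.exists_between hz.2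
    have hs0 : 0 < s := (Real.exp_pos _).trans hs1
    have hopen : IsOpen (sector d θ s) := isOpen_sector _ _ _
    refine (DifferentiableOn.differentiableAt (s := sector d θ s) ?_
      (hopen.mem_nhds ⟨hz.1, hs1⟩)).differentiableWithinAt
    obtain ⟨B, hB, hb⟩ := exists_norm_coeff_le_of_lt_convRadius (g := g) (r := (s + ρ') / 2)
      (by positivity) (((ENNReal.ofReal_lt_ofReal_iff hρ').mpr (by linarith)).trans_le h3)
    have hq : s / ((s + ρ') / 2) < 1 := (div_lt_one (by positivity)).mpr (by linarith)
    refine Complex.differentiableOn_tsum_of_summable_norm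
      (u := fun n => B * (s / ((s + ρ') / 2)) ^ n)
      ((summable_geometric_of_lt_one (by positivity) hq).mul_left B)
      (fun n => by fun_prop) hopen fun n x hx => ?_
    have hxs : ‖Complex.exp x‖ ≤ s := by rw [Complex.norm_exp]; exact hx.2.le
    rw [norm_mul, norm_pow, div_eq_inv_mul, mul_pow, ← mul_assoc]
    gcongr
    exact hb n
  have hSg : HasGevreyOneExpansion d θ ρ' S g :=
    hasGevreyOneExpansion_of_hasSum h3 fun z hz => (hsum z (hmem z hz)).hasSum
  have hsec : sector d θ ρ' ⊆ sector d θ ρ := sector_mono le_rfl h2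
  have hP := (HasGevreyOneExpansion.polyOp hd hG P).mono h2
  rw [show Polynomial.aeval (R := ℂ) (formalOp : Module.End ℂ (PowerSeries ℂ)) P f = g from h]
    at hP
  have hzero := hP.sub hSg
  rw [sub_self] at hzero
  have := hzero.eqOn_zero hθ (((differentiableOn_polyOp hd hG P).mono hsec).sub hSd)
    (⟨hw.1, h1⟩ : w ∈ sector d θ ρ')
  have heq : polyOp P F w = S w := sub_eq_zero.mp this
  rw [heq]
  exact (hsum w hwR).hasSum

/-- A series with a `1`-sum that is an actual solution is a formal solution. -/
lemma isFormalSolution_of_isActualSolution {P : Polynomial ℂ} {g f : PowerSeries ℂ}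
    (hg : IsConvergent g) {d θ ρ : ℝ} {F : ℂ → ℂ} (hF : IsOneSum f d θ ρ F)
    (h : IsActualSolution P g d θ ρ F) : IsFormalSolution P g f := by
  obtain ⟨hθ, hρ, hd, hG⟩ := hF
  obtain ⟨r, hr1, hr2⟩ := ENNReal.lt_iff_exists_nnreal_btwn.mp hg
  have hr0 : (0 : ℝ) < r := by exact_mod_cast hr1
  rw [← ENNReal.ofReal_coe_nnreal] at hr2
  have h1 : HasGevreyOneExpansion d θ (min ρ r) (polyOp P F) g := by
    refine hasGevreyOneExpansion_of_hasSum
      ((ENNReal.ofReal_le_ofReal (min_le_right _ _)).trans hr2.le) fun w hw => ?_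
    refine h w (sector_mono le_rfl (min_le_left _ _) hw) (lt_trans ?_ hr2)
    rw [← ofReal_norm, Complex.norm_exp]
    exact (ENNReal.ofReal_lt_ofReal_iff hr0).mpr (hw.2.trans_le (min_le_right _ _))
  have h2 := (HasGevreyOneExpansion.polyOp hd hG P).mono (min_le_left ρ r)
  have h3 := h2.sub h1
  simp only [sub_self] at h3
  exact sub_eq_zero.mp (h3.eq_zero (by linarith) (lt_min hρ hr0))

/-! ### Laplace integrals -/

open MeasureTheory

/-- The Laplace integral `∫_0^∞ ψ(t) e^{-tq} dt`. -/
noncomputable def laplace (ψ : ℝ → ℂ) (q : ℂ) : ℂ :=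
  ∫ t in Set.Ioi (0 : ℝ), ψ t * Complex.exp (-(t * q))

lemma norm_exp_neg_mul (t : ℝ) (q : ℂ) : ‖Complex.exp (-(t * q))‖ = Real.exp (-(q.re * t)) := by
  rw [Complex.norm_exp]; simp [mul_comm]

lemma integrableOn_pow_mul_exp_neg {r : ℝ} (hr : 0 < r) (N : ℕ) :
    IntegrableOn (fun t : ℝ => t ^ N * Real.exp (-(r * t))) (Set.Ioi 0) := by
  have := integrableOn_rpow_mul_exp_neg_mul_rpow (p := 1) (s := N) (b := r)
    (by have : (0 : ℝ) ≤ N := Nat.cast_nonneg N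
        linarith) one_pos hr
  simpa using this

lemma integral_pow_mul_exp_neg {r : ℝ} (hr : 0 < r) (N : ℕ) :
    ∫ t in Set.Ioi (0 : ℝ), t ^ N * Real.exp (-(r * t)) = N.factorial / r ^ (N + 1) := by
  have := Real.integral_rpow_mul_exp_neg_mul_Ioi (a := N + 1) (r := r) (by positivity) hr
  rw [Real.Gamma_nat_eq_factorial, add_sub_cancel_right] at this
  simp only [Real.rpow_natCast] at this
  rw [this, one_div, div_eq_inv_mul, ← Nat.cast_succ, Real.rpow_natCast, inv_pow]

lemma norm_mul_exp_neg_le {ψ : ℝ → ℂ} {C K : ℝ} {N : ℕ} {t : ℝ}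
    (hψ : ‖ψ t‖ ≤ C * t ^ N * Real.exp (K * t)) (q : ℂ) :
    ‖ψ t * Complex.exp (-(t * q))‖ ≤ C * (t ^ N * Real.exp (-((q.re - K) * t))) := by
  rw [norm_mul, norm_exp_neg_mul]
  calc ‖ψ t‖ * Real.exp (-(q.re * t))
      ≤ C * t ^ N * Real.exp (K * t) * Real.exp (-(q.re * t)) := by gcongr
    _ = _ := by rw [mul_assoc, ← Real.exp_add, mul_assoc]; ring_nf

lemma aestronglyMeasurable_mul_exp {ψ : ℝ → ℂ} (hc : ContinuousOn ψ (Set.Ioi 0)) (q : ℂ) :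
    AEStronglyMeasurable (fun t : ℝ => ψ t * Complex.exp (-(t * q)))
      (volume.restrict (Set.Ioi 0)) := by
  refine ContinuousOn.aestronglyMeasurable (hc.mul ?_) measurableSet_Ioi
  exact Continuous.continuousOn (by fun_prop)

lemma integrableOn_laplace {ψ : ℝ → ℂ} {C K : ℝ} {N : ℕ} (hc : ContinuousOn ψ (Set.Ioi 0))
    (hψ : ∀ t > 0, ‖ψ t‖ ≤ C * t ^ N * Real.exp (K * t)) {q : ℂ} (hq : K < q.re) :
    IntegrableOn (fun t : ℝ => ψ t * Complex.exp (-(t * q))) (Set.Ioi 0) := by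
  refine Integrable.mono' ((integrableOn_pow_mul_exp_neg (sub_pos.mpr hq) N).const_mul C)
    (aestronglyMeasurable_mul_exp hc q) ?_
  exact (ae_restrict_iff' measurableSet_Ioi).mpr
    (Filter.Eventually.of_forall fun t ht => norm_mul_exp_neg_le (hψ t ht) q)

lemma norm_laplace_le {ψ : ℝ → ℂ} {C K : ℝ} {N : ℕ}
    (hψ : ∀ t > 0, ‖ψ t‖ ≤ C * t ^ N * Real.exp (K * t)) {q : ℂ} (hq : K < q.re) :
    ‖laplace ψ q‖ ≤ C * (N.factorial / (q.re - K) ^ (N + 1)) := by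
  rw [← integral_pow_mul_exp_neg (sub_pos.mpr hq) N, ← integral_const_mul]
  refine norm_integral_le_of_norm_le
    ((integrableOn_pow_mul_exp_neg (sub_pos.mpr hq) N).const_mul C) ?_
  exact (ae_restrict_iff' measurableSet_Ioi).mpr
    (Filter.Eventually.of_forall fun t ht => norm_mul_exp_neg_le (hψ t ht) q)

/-- An abscissa m strictly between K and Re q supplies one integrable majorant of the q-derivative
for all Re z > m. -/
lemma differentiableAt_laplace {ψ : ℝ → ℂ} {C K : ℝ} (hc : ContinuousOn ψ (Set.Ioi 0))
    (hψ : ∀ t > 0, ‖ψ t‖ ≤ C * Real.exp (K * t)) {q : ℂ} (hq : K < q.re) :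
    DifferentiableAt ℂ (laplace ψ) q := by
  obtain ⟨m, hm1, hm2⟩ := _root_.exists_between hq
  have hψ0 : ∀ t > 0, ‖ψ t‖ ≤ C * t ^ 0 * Real.exp (K * t) := by simpa using hψ
  have hopen : {z : ℂ | m < z.re} ∈ nhds q :=
    (isOpen_lt continuous_const Complex.continuous_re).mem_nhds hm2
  have hψ1 : ∀ t : ℝ, t > 0 → ‖-(t : ℂ) * ψ t‖ ≤ C * t ^ 1 * Real.exp (K * t) := by
    intro t ht
    rw [norm_mul, norm_neg, Complex.norm_real, Real.norm_of_nonneg (le_of_lt ht), pow_one]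
    calc t * ‖ψ t‖ ≤ t * (C * Real.exp (K * t)) := by gcongr; exact hψ t ht
      _ = _ := by ring
  have hC : 0 ≤ C := by
    have := (norm_nonneg _).trans (hψ 1 one_pos)
    exact nonneg_of_mul_nonneg_left this (Real.exp_pos _)
  have h := hasDerivAt_integral_of_dominated_loc_of_deriv_le (𝕜 := ℂ)
    (μ := volume.restrict (Set.Ioi (0 : ℝ)))
    (F := fun (z : ℂ) (t : ℝ) => ψ t * Complex.exp (-(t * z)))
    (F' := fun (z : ℂ) (t : ℝ) => (-(t : ℂ) * ψ t) * Complex.exp (-(t * z)))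
    (bound := fun t => C * (t ^ 1 * Real.exp (-((m - K) * t))))
    (x₀ := q) hopen
    (Filter.Eventually.of_forall fun z => aestronglyMeasurable_mul_exp hc z)
    (integrableOn_laplace hc hψ0 hq)
    (aestronglyMeasurable_mul_exp (ψ := fun t => -(t : ℂ) * ψ t) (by fun_prop) q)
    ((ae_restrict_iff' measurableSet_Ioi).mpr (Filter.Eventually.of_forall fun t ht z hz => ?_))
    ((integrableOn_pow_mul_exp_neg (sub_pos.mpr hm1) 1).const_mul C)
    (Filter.Eventually.of_forall fun t z _ => ?_)
  · exact h.2.differentiableAt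
  · refine (norm_mul_exp_neg_le (ψ := fun t => -(t : ℂ) * ψ t) (hψ1 t ht) z).trans ?_
    have ht' : 0 < t := ht
    have hz' : m < z.re := hz
    gcongr
  · have h1 : HasDerivAt (fun z : ℂ => -(t * z)) (-(t : ℂ)) z := by
      simpa using ((hasDerivAt_id z).const_mul (t : ℂ)).fun_neg
    exact (h1.cexp.const_mul (ψ t)).congr_deriv (by ring)

lemma laplace_pow (p : ℕ) {q : ℂ} (hq : 0 < q.re) :
    laplace (fun t => (t : ℂ) ^ p) q = p.factorial / q ^ (p + 1) := by
  have hq0 : q ≠ 0 := by rintro rfl; simp at hq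
  have hint : ∀ n : ℕ, IntegrableOn (fun t : ℝ => (t : ℂ) ^ n * Complex.exp (-(t * q)))
      (Set.Ioi 0) := fun n =>
    integrableOn_laplace (C := 1) (K := 0) (N := n) (by fun_prop)
      (fun t ht => by simp [abs_of_pos ht]) hq
  have hlim : ∀ n : ℕ, Filter.Tendsto (fun t : ℝ => (t : ℂ) ^ n * Complex.exp (-(t * q)))
      Filter.atTop (nhds 0) := by
    intro n
    rw [tendsto_zero_iff_norm_tendsto_zero]
    refine (tendsto_rpow_mul_exp_neg_mul_atTop_nhds_zero n q.re hq).congr' ?_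
    filter_upwards [Filter.eventually_gt_atTop 0] with t ht
    rw [norm_mul, norm_exp_neg_mul, norm_pow, Complex.norm_real, Real.norm_of_nonneg ht.le,
      Real.rpow_natCast, neg_mul]
  have hder : ∀ (n : ℕ) (t : ℝ), HasDerivAt (fun t : ℝ => (t : ℂ) ^ n * Complex.exp (-(t * q)))
      (n * ((t : ℂ) ^ (n - 1) * Complex.exp (-(t * q))) -
        q * ((t : ℂ) ^ n * Complex.exp (-(t * q)))) t := by
    intro n t
    have h1 : HasDerivAt (fun t : ℝ => (t : ℂ)) 1 t := Complex.ofRealCLM.hasDerivAt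
    have h2 := (h1.fun_pow n).mul (h1.mul_const q).fun_neg.cexp
    exact h2.congr_deriv (by ring)
  -- Integration by parts. At n = 0 the truncated exponent n - 1 is multiplied by 0, and 0ⁿ is the
  -- boundary value at t = 0.
  have hftc : ∀ n : ℕ, (n : ℂ) * laplace (fun t => (t : ℂ) ^ (n - 1)) q -
      q * laplace (fun t => (t : ℂ) ^ n) q = 0 - (0 : ℂ) ^ n := by
    intro n
    have h1 := integral_Ioi_of_hasDerivAt_of_tendsto (a := (0 : ℝ))
      (f := fun t : ℝ => (t : ℂ) ^ n * Complex.exp (-(t * q)))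
      (hder n 0).continuousAt.continuousWithinAt (fun t _ => hder n t)
      (((hint (n - 1)).const_mul _).sub ((hint n).const_mul _)) (hlim n)
    rw [integral_sub ((hint (n - 1)).const_mul _) ((hint n).const_mul _), integral_const_mul,
      integral_const_mul] at h1
    simpa [laplace] using h1
  induction p with
  | zero =>
    have h1 := hftc 0
    simp only [Nat.cast_zero, zero_mul, zero_sub, pow_zero, neg_inj] at h1
    simp only [pow_zero, zero_add, pow_one, Nat.factorial_zero, Nat.cast_one]
    rw [eq_div_iff hq0, mul_comm]; exact h1
  | succ p ih =>
    have h1 := hftc (p + 1)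
    rw [Nat.add_sub_cancel, ih, zero_pow (by omega), sub_zero, sub_eq_zero] at h1
    rw [eq_div_iff (by positivity), pow_succ _ (p + 1), mul_comm (q ^ (p + 1)) q, ← mul_assoc,
      mul_comm _ q, ← h1, Nat.factorial_succ]
    push_cast
    field_simp

/-- Gevrey estimate for the Laplace integral. -/
lemma norm_mul_laplace_sub_le {ψ : ℝ → ℂ} {c : ℕ → ℂ} {C K κ : ℝ} {N : ℕ}
    (hc : ContinuousOn ψ (Set.Ioi 0)) {C₀ : ℝ} (hψ0 : ∀ t > 0, ‖ψ t‖ ≤ C₀ * Real.exp (K * t))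
    (hψ : ∀ t > 0, ‖ψ t - ∑ p ∈ range N, c p * (t : ℂ) ^ p‖ ≤ C * t ^ N * Real.exp (K * t))
    (hC : 0 ≤ C) (hK : 0 ≤ K) (hκ : 0 < κ) {q : ℂ} (hq : κ * ‖q‖ ≤ q.re - K) (hq0 : q ≠ 0) :
    ‖q * laplace ψ q - ∑ p ∈ range N, c p * p.factorial * (q⁻¹) ^ p‖ ≤
      C / κ * (1 / κ) ^ N * N.factorial * ‖q⁻¹‖ ^ N := by
  have hqn : 0 < ‖q‖ := norm_pos_iff.mpr hq0
  have hqK : K < q.re := by have := mul_pos hκ hqn; linarith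
  have hmono : ∀ p : ℕ, IntegrableOn (fun t : ℝ => (t : ℂ) ^ p * Complex.exp (-(t * q)))
      (Set.Ioi 0) := fun n =>
    integrableOn_laplace (C := 1) (K := 0) (N := n) (by fun_prop)
      (fun t ht => by simp [abs_of_pos ht]) (hK.trans_lt hqK)
  have h1 : laplace (fun t => ψ t - ∑ p ∈ range N, c p * (t : ℂ) ^ p) q =
      laplace ψ q - ∑ p ∈ range N, c p * (p.factorial / q ^ (p + 1)) := by
    have h2 : ∀ p, c p * (p.factorial / q ^ (p + 1)) =
        ∫ t in Set.Ioi (0 : ℝ), c p * ((t : ℂ) ^ p * Complex.exp (-(t * q))) := fun p => by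
      rw [integral_const_mul, ← laplace_pow p (hK.trans_lt hqK), laplace]
    simp only [h2]
    rw [← integral_finsetSum _ (fun p _ => (hmono p).const_mul _), laplace, laplace,
      ← integral_sub (integrableOn_laplace (N := 0) hc (by simpa using hψ0) hqK)
        (integrable_finsetSum _ fun p _ => (hmono p).const_mul _)]
    congr 1
    ext t
    rw [sub_mul, Finset.sum_mul]
    simp only [mul_assoc]
  -- The prefactor q turns p!/qᵖ⁺¹ into p!q⁻ᵖ: the remainder in 1/q is the Laplace integral of the
  -- remainder of ψ.
  have h2 : q * laplace ψ q - ∑ p ∈ range N, c p * p.factorial * (q⁻¹) ^ p =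
      q * laplace (fun t => ψ t - ∑ p ∈ range N, c p * (t : ℂ) ^ p) q := by
    rw [h1, mul_sub, Finset.mul_sum]
    congr 1
    refine Finset.sum_congr rfl fun p _ => ?_
    rw [pow_succ, inv_pow]; field_simp
  rw [h2, norm_mul]
  calc ‖q‖ * _ ≤ ‖q‖ * (C * (N.factorial / (q.re - K) ^ (N + 1))) := by
        gcongr; exact norm_laplace_le hψ hqK
    _ ≤ ‖q‖ * (C * (N.factorial / (κ * ‖q‖) ^ (N + 1))) := by gcongr
    _ = _ := by rw [norm_inv, mul_pow, pow_succ, pow_succ, div_pow, inv_pow, one_pow]; field_simp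

/-! ### Borel–Laplace summation -/

/-- The Laplace integral of `φ` along the ray of argument `τ`, as a function of `w = log z`. -/
noncomputable def rayLaplace (φ : ℂ → ℂ) (τ : ℝ) (w : ℂ) : ℂ :=
  Complex.exp (τ * Complex.I - w) *
    laplace (fun t => φ (t * Complex.exp (τ * Complex.I))) (Complex.exp (τ * Complex.I - w))

lemma integral_exp_smul_comp_exp (g : ℝ → ℂ) :
    ∫ x : ℝ, Real.exp x • g (Real.exp x) = ∫ t in Set.Ioi (0 : ℝ), g t := by
  have := integral_image_eq_integral_abs_deriv_smul MeasurableSet.univ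
    (fun x _ => (Real.hasDerivAt_exp x).hasDerivWithinAt) Real.exp_injective.injOn g
  rw [Set.image_univ, Real.range_exp] at this
  rw [this, setIntegral_univ]
  simp

lemma integrable_exp_smul_comp_exp {g : ℝ → ℂ} (hg : IntegrableOn g (Set.Ioi 0)) :
    Integrable fun x : ℝ => Real.exp x • g (Real.exp x) := by
  have := integrableOn_image_iff_integrableOn_abs_deriv_smul MeasurableSet.univ
    (fun x _ => (Real.hasDerivAt_exp x).hasDerivWithinAt) Real.exp_injective.injOn g
  rw [Set.image_univ, Real.range_exp] at this
  simpa using this.mp hg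

/-- Rotation of the ray of integration. -/
lemma rayLaplace_eq_of_forall {φ : ℂ → ℂ} {τ₁ τ₂ C K m : ℝ} (hτ : τ₁ ≤ τ₂) (hm : K < m)
    (hd : ∀ τ ∈ Set.Icc τ₁ τ₂, ∀ t : ℝ, 0 ≤ t →
      DifferentiableAt ℂ φ (t * Complex.exp (τ * Complex.I)))
    (hb : ∀ τ ∈ Set.Icc τ₁ τ₂, ∀ t : ℝ, 0 ≤ t →
      ‖φ (t * Complex.exp (τ * Complex.I))‖ ≤ C * Real.exp (K * t))
    {w : ℂ} (hw : ∀ τ ∈ Set.Icc τ₁ τ₂, m ≤ (Complex.exp (τ * Complex.I - w)).re) :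
    rayLaplace φ τ₁ w = rayLaplace φ τ₂ w := by
  -- The substitution te^(iτ) = e^u turns rays into horizontal lines, so Cauchy's theorem is needed
  -- only on rectangles. The vertical sides vanish at -∞ because of the factor e^u, and at +∞
  -- because m > K.
  set H : ℂ → ℂ := fun u =>
    φ (Complex.exp u) * Complex.exp (-(Complex.exp u * Complex.exp (-w))) * Complex.exp u with hH
  have hC : 0 ≤ C := by
    have := (norm_nonneg _).trans (hb τ₁ ⟨le_rfl, hτ⟩ 0 le_rfl)
    simpa using this
  have hexp : ∀ x τ : ℝ, Complex.exp (x + τ * Complex.I) =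
      (Real.exp x : ℂ) * Complex.exp (τ * Complex.I) := fun x τ => by
    rw [Complex.exp_add, Complex.ofReal_exp]
  have hsub : ∀ τ : ℝ, Complex.exp (τ * Complex.I) * Complex.exp (-w) =
      Complex.exp (τ * Complex.I - w) := fun τ => by rw [← Complex.exp_add, sub_eq_add_neg]
  have hHeq : ∀ x τ : ℝ, H (x + τ * Complex.I) = Real.exp x •
      (Complex.exp (τ * Complex.I) * (φ ((Real.exp x : ℝ) * Complex.exp (τ * Complex.I)) *
        Complex.exp (-((Real.exp x : ℝ) * Complex.exp (τ * Complex.I - w))))) := fun x τ => by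
    simp only [hH]
    rw [hexp, mul_assoc ((Real.exp x : ℝ) : ℂ), hsub, Complex.real_smul]; ring
  have hcont : ∀ τ ∈ Set.Icc τ₁ τ₂,
      ContinuousOn (fun t : ℝ => φ (t * Complex.exp (τ * Complex.I))) (Set.Ioi 0) := by
    intro τ hτ' t ht
    have h1 : ContinuousAt (fun t : ℝ => (t : ℂ) * Complex.exp (τ * Complex.I)) t := by fun_prop
    exact (ContinuousAt.comp (f := fun t : ℝ => (t : ℂ) * Complex.exp (τ * Complex.I))
      (hd τ hτ' t (le_of_lt ht)).continuousAt h1).continuousWithinAt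
  have hinteg : ∀ τ ∈ Set.Icc τ₁ τ₂, IntegrableOn (fun t : ℝ => Complex.exp (τ * Complex.I) *
      (φ (t * Complex.exp (τ * Complex.I)) *
        Complex.exp (-(t * Complex.exp (τ * Complex.I - w))))) (Set.Ioi 0) := fun τ hτ' =>
    (integrableOn_laplace (N := 0) (hcont τ hτ')
      (fun t ht => by simpa using hb τ hτ' t (le_of_lt ht)) (hm.trans_le (hw τ hτ'))).const_mul _
  have hray : ∀ τ : ℝ, rayLaplace φ τ w =
      Complex.exp (-w) * ∫ x : ℝ, H (x + τ * Complex.I) := by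
    intro τ
    simp only [hHeq]
    rw [integral_exp_smul_comp_exp (fun t : ℝ => Complex.exp (τ * Complex.I) *
      (φ (t * Complex.exp (τ * Complex.I)) *
        Complex.exp (-(t * Complex.exp (τ * Complex.I - w))))), integral_const_mul, rayLaplace,
      laplace, ← hsub]
    ring
  have hHint : ∀ τ ∈ Set.Icc τ₁ τ₂, Integrable fun x : ℝ => H (x + τ * Complex.I) := by
    intro τ hτ'
    simp only [hHeq]
    exact integrable_exp_smul_comp_exp (hinteg τ hτ')
  have hHnorm : ∀ x : ℝ, ∀ τ ∈ Set.Icc τ₁ τ₂, ‖H (x + τ * Complex.I)‖ ≤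
      C * (Real.exp x * Real.exp (-((m - K) * Real.exp x))) := by
    intro x τ hτ'
    rw [hHeq, norm_smul, norm_mul, Complex.norm_exp_ofReal_mul_I, one_mul, Real.norm_eq_abs,
      Real.abs_exp]
    have h1 := norm_mul_exp_neg_le (ψ := fun t : ℝ => φ (t * Complex.exp (τ * Complex.I)))
      (N := 0) (t := Real.exp x) (C := C) (K := K)
      (by simpa using hb τ hτ' _ (Real.exp_pos x).le) (Complex.exp (τ * Complex.I - w))
    rw [pow_zero, one_mul] at h1
    have h2 := hw τ hτ'
    calc _ ≤ Real.exp x *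
          (C * Real.exp (-(((Complex.exp (τ * Complex.I - w)).re - K) * Real.exp x))) := by
          gcongr
      _ ≤ Real.exp x * (C * Real.exp (-((m - K) * Real.exp x))) := by gcongr
      _ = _ := by ring
  have hbt : Filter.Tendsto
      (fun x : ℝ => C * (Real.exp x * Real.exp (-((m - K) * Real.exp x)))) Filter.atBot
      (nhds 0) := by
    have h1 : Continuous fun t : ℝ => C * (t * Real.exp (-((m - K) * t))) := by fun_prop
    have h2 := (h1.tendsto 0).comp Real.tendsto_exp_atBot
    simpa [Function.comp_def] using h2
  have htp : Filter.Tendsto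
      (fun x : ℝ => C * (Real.exp x * Real.exp (-((m - K) * Real.exp x)))) Filter.atTop
      (nhds 0) := by
    have h1 := (tendsto_rpow_mul_exp_neg_mul_atTop_nhds_zero 1 (m - K) (sub_pos.mpr hm)).const_mul C
    have h2 := h1.comp Real.tendsto_exp_atTop
    simpa only [Function.comp_def, neg_mul, Real.rpow_one, mul_zero] using h2
  have hvert : ∀ x : ℝ, ‖∫ y in τ₁..τ₂, H (x + y * Complex.I)‖ ≤
      C * (Real.exp x * Real.exp (-((m - K) * Real.exp x))) * |τ₂ - τ₁| := fun x => by
    refine intervalIntegral.norm_integral_le_of_norm_le_const fun y hy => hHnorm x y ?_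
    rw [Set.uIoc_of_le hτ] at hy
    exact Set.Ioc_subset_Icc_self hy
  have hV1 : Filter.Tendsto (fun x : ℝ => ∫ y in τ₁..τ₂, H (x + y * Complex.I)) Filter.atTop
      (nhds 0) := squeeze_zero_norm hvert (by simpa using htp.mul_const |τ₂ - τ₁|)
  have hV2 : Filter.Tendsto (fun x : ℝ => ∫ y in τ₁..τ₂, H ((-x : ℝ) + y * Complex.I))
      Filter.atTop (nhds 0) :=
    Filter.Tendsto.comp (g := fun x : ℝ => ∫ y in τ₁..τ₂, H (x + y * Complex.I))
      (squeeze_zero_norm hvert (by simpa using hbt.mul_const |τ₂ - τ₁|)) Filter.tendsto_neg_atTop_atBot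
  have hT : ∀ τ ∈ Set.Icc τ₁ τ₂, Filter.Tendsto
      (fun X : ℝ => ∫ x in (-X)..X, H (x + τ * Complex.I)) Filter.atTop
      (nhds (∫ x : ℝ, H (x + τ * Complex.I))) := fun τ hτ' =>
    intervalIntegral_tendsto_integral (hHint τ hτ') Filter.tendsto_neg_atTop_atBot Filter.tendsto_id
  have hrect : ∀ X : ℝ, (((∫ x in (-X)..X, H (x + τ₁ * Complex.I)) -
      ∫ x in (-X)..X, H (x + τ₂ * Complex.I)) +
      Complex.I • ∫ y in τ₁..τ₂, H (X + y * Complex.I)) -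
      Complex.I • ∫ y in τ₁..τ₂, H ((-X : ℝ) + y * Complex.I) = 0 := by
    intro X
    have h1 := Complex.integral_boundary_rect_eq_zero_of_differentiableOn H
      ((-X : ℝ) + τ₁ * Complex.I) (X + τ₂ * Complex.I) ?_
    · simpa using h1
    · intro u hu
      have hu2 : u.im ∈ Set.Icc τ₁ τ₂ := by
        have := hu.2
        simpa [Set.uIcc_of_le hτ] using this
      have hu3 : Complex.exp u = (Real.exp u.re : ℝ) * Complex.exp (u.im * Complex.I) := by
        rw [← hexp, Complex.re_add_im]
      have h2 : DifferentiableAt ℂ φ (Complex.exp u) := by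
        rw [hu3]; exact hd _ hu2 _ (Real.exp_pos _).le
      have h3 : DifferentiableAt ℂ (fun u => φ (Complex.exp u)) u :=
        DifferentiableAt.comp u h2 Complex.differentiableAt_exp
      have h4 : DifferentiableAt ℂ
          (fun u => Complex.exp (-(Complex.exp u * Complex.exp (-w)))) u := by fun_prop
      exact ((h3.mul h4).mul Complex.differentiableAt_exp).differentiableWithinAt
  have hlim := (((hT τ₁ ⟨le_rfl, hτ⟩).sub (hT τ₂ ⟨hτ, le_rfl⟩)).add
    (hV1.const_smul Complex.I)).sub (hV2.const_smul Complex.I)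
  have h0 := tendsto_nhds_unique (hlim.congr hrect) tendsto_const_nhds
  rw [smul_zero, add_zero, sub_zero, sub_eq_zero] at h0
  rw [hray, hray, h0]

lemma sin_le_cos_of_abs_le {x α : ℝ} (hx : 0 ≤ x) (hα : |α| ≤ Real.pi / 2 - x) :
    Real.sin x ≤ Real.cos α := by
  rw [← Real.cos_pi_div_two_sub, ← Real.cos_abs α]
  exact Real.cos_le_cos_of_nonneg_of_le_pi (abs_nonneg _) (by linarith [Real.pi_pos]) hα

/-- A formal series is `1`-summable if its Borel transform has an analytic continuation of
exponential growth to a sector around the given direction. -/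
lemma isOneSummable_of_borel {f : PowerSeries ℂ} {φ : ℂ → ℂ} {d δ C A K : ℝ} (hδ : 0 < δ)
    (hδ' : δ ≤ Real.pi / 8) (hC : 0 < C) (hA : 0 < A) (hK : 0 < K)
    (hd : ∀ τ : ℝ, |τ - d| ≤ δ → ∀ t : ℝ, 0 ≤ t →
      DifferentiableAt ℂ φ (t * Complex.exp (τ * Complex.I)))
    (hb : ∀ τ : ℝ, |τ - d| ≤ δ → ∀ t : ℝ, 0 ≤ t → ∀ N : ℕ,
      ‖φ (t * Complex.exp (τ * Complex.I)) - ∑ p ∈ range N, PowerSeries.coeff p (borel f) *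
        (t * Complex.exp (τ * Complex.I)) ^ p‖ ≤ C * A ^ N * t ^ N * Real.exp (K * t)) :
    IsOneSummable f d := by
  have hπ := Real.pi_pos
  -- If τ and Im w differ by at most π/2 - δ/2, then q = e^(iτ-w) satisfies Re q ≥ κ|q|. The choice
  -- of `ρ` adds Re q ≥ 2K, and averaging the two gives Re q - K ≥ (κ/2)|q|.
  set κ : ℝ := Real.sin (δ / 2) with hκ
  have hκ0 : 0 < κ := Real.sin_pos_of_pos_of_lt_pi (by linarith) (by linarith)
  set ρ : ℝ := κ / (2 * K) with hρ
  have hρ0 : 0 < ρ := by positivity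
  have hqn : ∀ (τ : ℝ) (w : ℂ), ‖Complex.exp (τ * Complex.I - w)‖ = Real.exp (-w.re) := fun τ w => by
    rw [Complex.norm_exp]; simp
  have hq2 : ∀ (τ : ℝ) (w : ℂ), Real.exp w.re < ρ → |τ - w.im| ≤ Real.pi / 2 - δ / 2 →
      2 * K ≤ (Complex.exp (τ * Complex.I - w)).re := by
    intro τ w hw hτ
    have h1 := sin_le_cos_of_abs_le (by linarith) hτ
    have h2 : 2 * K ≤ κ * Real.exp (-w.re) := by
      rw [Real.exp_neg, ← div_eq_mul_inv, le_div_iff₀ (Real.exp_pos _)]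
      rw [hρ, lt_div_iff₀ (by positivity)] at hw
      linarith
    rw [Complex.exp_re]
    simp only [Complex.sub_re, Complex.mul_re, Complex.ofReal_re, Complex.I_re, mul_zero,
      Complex.ofReal_im, Complex.I_im, mul_one, sub_self, zero_sub, Complex.sub_im, Complex.mul_im,
      add_zero]
    have h3 := Real.exp_pos (-w.re)
    nlinarith
  have hq1 : ∀ (τ : ℝ) (w : ℂ), Real.exp w.re < ρ → |τ - w.im| ≤ Real.pi / 2 - δ / 2 →
      κ / 2 * ‖Complex.exp (τ * Complex.I - w)‖ ≤ (Complex.exp (τ * Complex.I - w)).re - K := by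
    intro τ w hw hτ
    have h1 := sin_le_cos_of_abs_le (by linarith) hτ
    have h2 := hq2 τ w hw hτ
    have h4 : κ * Real.exp (-w.re) ≤ (Complex.exp (τ * Complex.I - w)).re := by
      rw [Complex.exp_re]
      simp only [Complex.sub_re, Complex.mul_re, Complex.ofReal_re, Complex.I_re, mul_zero,
        Complex.ofReal_im, Complex.I_im, mul_one, sub_self, zero_sub, Complex.sub_im,
        Complex.mul_im, add_zero]
      have h3 := Real.exp_pos (-w.re)
      nlinarith
    rw [hqn]
    linarith
  have hcont : ∀ τ : ℝ, |τ - d| ≤ δ →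
      ContinuousOn (fun t : ℝ => φ (t * Complex.exp (τ * Complex.I))) (Set.Ioi 0) := by
    intro τ hτ' t ht
    have h1 : ContinuousAt (fun t : ℝ => (t : ℂ) * Complex.exp (τ * Complex.I)) t := by fun_prop
    exact (ContinuousAt.comp (f := fun t : ℝ => (t : ℂ) * Complex.exp (τ * Complex.I))
      (hd τ hτ' t (le_of_lt ht)).continuousAt h1).continuousWithinAt
  have hgrowth : ∀ τ : ℝ, |τ - d| ≤ δ → ∀ t : ℝ, 0 ≤ t →
      ‖φ (t * Complex.exp (τ * Complex.I))‖ ≤ C * Real.exp (K * t) := fun τ hτ t ht => by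
    simpa using hb τ hτ t ht 0
  have hdiff : ∀ (τ : ℝ) (w : ℂ), |τ - d| ≤ δ → Real.exp w.re < ρ →
      |τ - w.im| ≤ Real.pi / 2 - δ / 2 → DifferentiableAt ℂ (rayLaplace φ τ) w := by
    intro τ w hτ hw hτw
    have h1 : K < (Complex.exp (τ * Complex.I - w)).re := by linarith [hq2 τ w hw hτw]
    have h2 := differentiableAt_laplace (hcont τ hτ) (fun t ht => hgrowth τ hτ t (le_of_lt ht)) h1
    have h3 : DifferentiableAt ℂ (fun w => Complex.exp (τ * Complex.I - w)) w := by fun_prop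
    exact h3.mul (DifferentiableAt.fun_comp' w h2 h3)
  have hgev : ∀ (τ : ℝ) (w : ℂ) (N : ℕ), |τ - d| ≤ δ → Real.exp w.re < ρ →
      |τ - w.im| ≤ Real.pi / 2 - δ / 2 →
      ‖rayLaplace φ τ w - ∑ p ∈ range N, PowerSeries.coeff p f * Complex.exp w ^ p‖ ≤
        2 * C / κ * (2 * A / κ) ^ N * N.factorial * ‖Complex.exp w‖ ^ N := by
    intro τ w N hτ hw hτw
    have h1 := norm_mul_laplace_sub_le (N := N)
      (c := fun p => PowerSeries.coeff p (borel f) * Complex.exp (τ * Complex.I) ^ p)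
      (hcont τ hτ) (fun t ht => hgrowth τ hτ t (le_of_lt ht)) (C := C * A ^ N)
      (fun t ht => by
        have := hb τ hτ t (le_of_lt ht) N
        simp only [mul_pow] at this
        simpa only [mul_assoc, mul_comm, mul_left_comm] using this)
      (by positivity) hK.le (half_pos hκ0) (hq1 τ w hw hτw) (Complex.exp_ne_zero _)
    have h2 : (Complex.exp (τ * Complex.I - w))⁻¹ =
        Complex.exp w * (Complex.exp (τ * Complex.I))⁻¹ := by
      rw [← Complex.exp_neg, ← Complex.exp_neg, ← Complex.exp_add]; congr 1; ring
    have h3 : ‖(Complex.exp (τ * Complex.I - w))⁻¹‖ = ‖Complex.exp w‖ := by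
      rw [norm_inv, hqn, Complex.norm_exp, Real.exp_neg, inv_inv]
    have h4 : ∑ p ∈ range N, PowerSeries.coeff p (borel f) * Complex.exp (τ * Complex.I) ^ p *
        p.factorial * (Complex.exp (τ * Complex.I - w))⁻¹ ^ p =
        ∑ p ∈ range N, PowerSeries.coeff p f * Complex.exp w ^ p := by
      refine Finset.sum_congr rfl fun p _ => ?_
      have := Complex.exp_ne_zero (τ * Complex.I)
      rw [h2, coeff_eq_factorial_mul_borel f p, mul_pow, inv_pow]
      field_simp
    rw [h3, h4] at h1
    refine h1.trans_eq ?_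
    rw [div_pow, div_pow, div_pow, mul_pow, one_pow]
    field_simp
  have habs1 : |d + δ - d| ≤ δ := by rw [add_sub_cancel_left, abs_of_pos hδ]
  have habs2 : |d - δ - d| ≤ δ := by rw [sub_sub_cancel_left, abs_neg, abs_of_pos hδ]
  have hglue : ∀ w : ℂ, Real.exp w.re < ρ → |w.im - d| ≤ δ →
      rayLaplace φ (d - δ) w = rayLaplace φ (d + δ) w := by
    intro w hw hwd
    have hI : ∀ τ ∈ Set.Icc (d - δ) (d + δ), |τ - d| ≤ δ := fun τ hτ =>
      abs_le.mpr ⟨by linarith [hτ.1], by linarith [hτ.2]⟩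
    refine rayLaplace_eq_of_forall (C := C) (K := K) (m := 2 * K) (by linarith) (by linarith)
      (fun τ hτ => hd τ (hI τ hτ)) (fun τ hτ => hgrowth τ (hI τ hτ)) fun τ hτ => hq2 τ w hw ?_
    rw [abs_le] at hwd ⊢
    constructor <;> linarith [hτ.1, hτ.2, hwd.1, hwd.2]
  have hθ : Real.pi * (1 + δ / Real.pi) / 2 = Real.pi / 2 + δ / 2 := by field_simp
  -- The upper half of the sector uses the ray d + δ, the lower half d - δ. Each ray reaches π/2 -
  -- δ/2 beyond its own direction, hence π/2 + δ/2 from d; δ ≤ π/8 keeps the middle within reach of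
  -- both.
  set F : ℂ → ℂ := fun w => if d ≤ w.im then rayLaplace φ (d + δ) w else rayLaplace φ (d - δ) w
    with hF
  refine ⟨1 + δ / Real.pi, ρ, F, ?_, hρ0, ?_, ?_⟩
  · have : 0 < δ / Real.pi := by positivity
    linarith
  · intro w hw
    have hw1 := abs_lt.mp (hθ ▸ hw.1)
    have hnear : ∀ᶠ z : ℂ in nhds w, Real.exp z.re < ρ :=
      (show Continuous fun z : ℂ => Real.exp z.re by fun_prop).continuousAt.eventually
        (gt_mem_nhds hw.2)
    refine DifferentiableAt.differentiableWithinAt ?_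
    rcases lt_or_ge w.im d with h | h
    · have he : F =ᶠ[nhds w] rayLaplace φ (d - δ) := by
        filter_upwards [Complex.continuous_im.continuousAt.eventually (gt_mem_nhds h)] with z hz
        simp [hF, not_le.mpr hz]
      refine (hdiff (d - δ) w habs2 hw.2 ?_).congr_of_eventuallyEq he
      rw [abs_le]; constructor <;> linarith [hw1.1, hw1.2]
    -- At Im w = d the definition switches branch; `hglue` identifies the two branches nearby.
    · have he : F =ᶠ[nhds w] rayLaplace φ (d + δ) := by
        filter_upwards [hnear, Complex.continuous_im.continuousAt.eventually
          (lt_mem_nhds (show d - δ < w.im by linarith))] with z hz1 hz2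
        rcases lt_or_ge z.im d with h' | h'
        · simp only [hF, not_le.mpr h', if_false]
          exact hglue z hz1 (abs_le.mpr ⟨by linarith, by linarith⟩)
        · simp [hF, h']
      refine (hdiff (d + δ) w habs1 hw.2 ?_).congr_of_eventuallyEq he
      rw [abs_le]; constructor <;> linarith [hw1.1, hw1.2]
  · intro d' θ' ρ' hθ' hρ' hsub
    refine ⟨2 * C / κ, 2 * A / κ, by positivity, by positivity, fun N w hw => ?_⟩
    have hwS := subset_closure.trans hsub hw
    have hw1 := abs_lt.mp (hθ ▸ hwS.1)
    rcases lt_or_ge w.im d with h | h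
    · have : F w = rayLaplace φ (d - δ) w := by simp [hF, not_le.mpr h]
      rw [this]
      refine hgev (d - δ) w N habs2 hwS.2 ?_
      rw [abs_le]; constructor <;> linarith [hw1.1, hw1.2]
    · have : F w = rayLaplace φ (d + δ) w := by simp [hF, h]
      rw [this]
      refine hgev (d + δ) w N habs1 hwS.2 ?_
      rw [abs_le]; constructor <;> linarith [hw1.1, hw1.2]

/-! ### Growth of the quotient of the Borel transform of g by P -/

/-- The directions that are not arguments of a root form an open set. -/
lemma exists_forall_not_isRoot {P : Polynomial ℂ} (hP : P ≠ 0) {d : ℝ}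
    (hd : ∀ ζ : ℂ, P.IsRoot ζ → ¬ IsArgument d ζ) :
    ∃ δ > 0, δ ≤ Real.pi / 8 ∧ ∀ τ : ℝ, |τ - d| ≤ δ → ∀ t : ℝ, 0 ≤ t →
      P.eval (t * Complex.exp (τ * Complex.I)) ≠ 0 := by
  have h1 : ∀ ζ ∈ P.roots.toFinset, ∀ᶠ τ : ℝ in nhds d, ¬ IsArgument τ ζ := by
    intro ζ hζ
    have hcl : IsClosed {τ : ℝ | IsArgument τ ζ} := by
      unfold IsArgument
      exact isClosed_eq continuous_const (by fun_prop)
    exact hcl.isOpen_compl.mem_nhds (hd ζ (Polynomial.isRoot_of_mem_roots (by simpa using hζ)))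
  have h2 := (Filter.eventually_all_finset _).mpr h1
  obtain ⟨ε, hε, hball⟩ := Metric.eventually_nhds_iff.mp h2
  have hπ := Real.pi_pos
  refine ⟨min (ε / 2) (Real.pi / 8), by positivity, min_le_right _ _, fun τ hτ t ht h3 => ?_⟩
  have h4 : dist τ d < ε := by
    rw [Real.dist_eq]
    have := hτ.trans (min_le_left _ _)
    linarith
  -- The case t = 0 needs no separate treatment: every real number is an argument of 0, so `hd` also
  -- excludes a root at 0.
  refine hball h4 _ (by simpa [hP] using h3) ?_
  simp [IsArgument, abs_of_nonneg ht, Complex.norm_exp]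

/-- A polynomial without zeros in a closed sector is bounded below there. -/
lemma exists_le_norm_eval {P : Polynomial ℂ} {d δ : ℝ} (hδ : 0 < δ)
    (h : ∀ τ : ℝ, |τ - d| ≤ δ → ∀ t : ℝ, 0 ≤ t →
      P.eval (t * Complex.exp (τ * Complex.I)) ≠ 0) :
    ∃ c > 0, ∀ τ : ℝ, |τ - d| ≤ δ → ∀ t : ℝ, 0 ≤ t →
      c ≤ ‖P.eval (t * Complex.exp (τ * Complex.I))‖ := by
  rcases Nat.eq_zero_or_pos P.natDegree with hn | hn
  · rw [Polynomial.eq_C_of_natDegree_eq_zero hn] at h ⊢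
    simp only [Polynomial.eval_C] at h ⊢
    exact ⟨_, norm_pos_iff.mpr (h d (by simpa using hδ.le) 0 le_rfl), fun _ _ _ _ => le_rfl⟩
  -- Far out |P| ≥ 1; on the remaining compact set of parameters |P| attains a positive minimum.
  · have hlim := P.tendsto_norm_atTop (Polynomial.natDegree_pos_iff_degree_pos.mp hn)
      tendsto_norm_cobounded_atTop
    have h1 := hlim.eventually_ge_atTop 1
    rw [← comap_norm_atTop, Filter.eventually_comap] at h1
    obtain ⟨T, hT⟩ := Filter.eventually_atTop.mp h1
    set S : Set (ℝ × ℝ) := Set.Icc (d - δ) (d + δ) ×ˢ Set.Icc 0 (max T 0) with hS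
    have hSc : IsCompact S := isCompact_Icc.prod isCompact_Icc
    have hcont : Continuous fun p : ℝ × ℝ =>
        ‖P.eval ((p.2 : ℂ) * Complex.exp (p.1 * Complex.I))‖ := by
      have := P.continuous
      fun_prop
    obtain ⟨p, hp, hmin⟩ := hSc.exists_isMinOn
      ⟨(d, 0), ⟨⟨by linarith, by linarith⟩, ⟨le_rfl, le_max_right _ _⟩⟩⟩ hcont.continuousOn
    refine ⟨min 1 ‖P.eval ((p.2 : ℂ) * Complex.exp (p.1 * Complex.I))‖, lt_min one_pos ?_, ?_⟩
    · exact norm_pos_iff.mpr (h p.1 (abs_le.mpr ⟨by linarith [hp.1.1], by linarith [hp.1.2]⟩) p.2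
        hp.2.1)
    · intro τ hτ t ht
      rw [abs_le] at hτ
      rcases le_or_gt t (max T 0) with h2 | h2
      · exact (min_le_right _ _).trans
          (hmin (show (τ, t) ∈ S from ⟨⟨by linarith, by linarith⟩, ⟨ht, h2⟩⟩))
      · refine (min_le_left _ _).trans (hT t ((le_max_left _ _).trans h2.le) _ ?_)
        rw [norm_mul, Complex.norm_exp_ofReal_mul_I, Complex.norm_real, Real.norm_of_nonneg ht,
          mul_one]

/-- The Borel transform of a convergent series is entire of exponential type. -/
lemma borel_entire {g : PowerSeries ℂ} {C M : ℝ} (hM : 0 < M)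
    (hb : ∀ n, ‖PowerSeries.coeff n g‖ ≤ C * M ^ n) :
    ∃ γ : ℂ → ℂ, Differentiable ℂ γ ∧ (∀ x, ‖γ x‖ ≤ C * Real.exp (M * ‖x‖)) ∧
      ∀ x, HasSum (fun n => PowerSeries.coeff n (borel g) * x ^ n) (γ x) := by
  have hC : 0 ≤ C := by simpa using (norm_nonneg _).trans (hb 0)
  have hterm : ∀ (r : ℝ) (x : ℂ), ‖x‖ ≤ r → ∀ n, ‖PowerSeries.coeff n (borel g) * x ^ n‖ ≤
      C * ((M * r) ^ n / n.factorial) := by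
    intro r x hx n
    rw [norm_mul, norm_pow, coeff_borel, norm_div, Complex.norm_natCast]
    calc ‖PowerSeries.coeff n g‖ / n.factorial * ‖x‖ ^ n
        ≤ C * M ^ n / n.factorial * r ^ n := by gcongr; exact hb n
      _ = _ := by rw [mul_pow]; ring
  have hexp : ∀ r : ℝ, HasSum (fun n : ℕ => C * ((M * r) ^ n / n.factorial))
      (C * Real.exp (M * r)) := fun r => by
    rw [Real.exp_eq_exp_ℝ]
    exact (NormedSpace.expSeries_div_hasSum_exp (M * r)).mul_left C
  have hsum : ∀ x : ℂ, Summable fun n => PowerSeries.coeff n (borel g) * x ^ n := fun x =>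
    Summable.of_norm_bounded (hexp ‖x‖).summable (hterm ‖x‖ x le_rfl)
  refine ⟨fun x => ∑' n, PowerSeries.coeff n (borel g) * x ^ n, fun x => ?_,
    fun x => tsum_of_norm_bounded (hexp ‖x‖) (hterm ‖x‖ x le_rfl), fun x => (hsum x).hasSum⟩
  refine DifferentiableOn.differentiableAt (s := Metric.ball 0 (‖x‖ + 1)) ?_
    (Metric.isOpen_ball.mem_nhds (by simp))
  refine Complex.differentiableOn_tsum_of_summable_norm (hexp (‖x‖ + 1)).summable
    (fun n => by fun_prop) Metric.isOpen_ball fun n y hy => hterm _ y ?_ n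
  exact (mem_ball_zero_iff.mp hy).le

/-- Division by a polynomial preserves geometric bounds on coefficients. -/
lemma exists_norm_coeff_le_of_mul {P : Polynomial ℂ} (h0 : P.eval 0 ≠ 0) {φ γ : PowerSeries ℂ}
    (h : (P : PowerSeries ℂ) * φ = γ) {C M : ℝ} (hC : 0 < C) (hM : 0 < M)
    (hb : ∀ n, ‖PowerSeries.coeff n γ‖ ≤ C * M ^ n) :
    ∃ B R : ℝ, 0 < B ∧ 0 < R ∧ ∀ n, ‖PowerSeries.coeff n φ‖ ≤ B * R ^ n := by
  have hP : 0 < ‖P.coeff 0‖ := by rw [Polynomial.coeff_zero_eq_eval_zero]; exact norm_pos_iff.mpr h0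
  set S : ℝ := ∑ i ∈ range (P.natDegree + 1), ‖P.coeff i‖ with hS
  have hS0 : 0 ≤ S := Finset.sum_nonneg fun _ _ => norm_nonneg _
  have hSle : ∀ j : ℕ, ∑ i ∈ range j, ‖P.coeff (i + 1)‖ ≤ S := by
    intro j
    calc ∑ i ∈ range j, ‖P.coeff (i + 1)‖ ≤ ∑ i ∈ range (j + 1), ‖P.coeff i‖ := by
          rw [Finset.sum_range_succ' _ j]; linarith [norm_nonneg (P.coeff 0)]
      _ ≤ ∑ i ∈ range (j + 1 + (P.natDegree + 1)), ‖P.coeff i‖ :=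
          Finset.sum_le_sum_of_subset_of_nonneg (range_mono (by omega))
            fun _ _ _ => norm_nonneg _
      _ = S := by
          symm
          refine Finset.sum_subset (range_mono (by omega)) fun i _ hi => ?_
          rw [mem_range, not_lt] at hi
          rw [Polynomial.coeff_eq_zero_of_natDegree_lt (by omega), norm_zero]
  -- R dominates 1, M and 2S/|P(0)|. In the induction the right-hand side and the convolution then
  -- each contribute at most C Rⁿ, which explains the 2 in 2C/|P(0)|.
  set R : ℝ := 1 + M + 2 * S / ‖P.coeff 0‖ with hR
  have hR1 : 1 ≤ R := by have : 0 ≤ 2 * S / ‖P.coeff 0‖ := by positivity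
                         linarith
  have hRM : M ≤ R := by have : 0 ≤ 2 * S / ‖P.coeff 0‖ := by positivity
                         linarith
  have hRS : 2 * S ≤ ‖P.coeff 0‖ * R := by
    rw [hR, mul_add, mul_div_cancel₀ _ hP.ne']
    nlinarith
  have hR0 : 0 < R := by linarith
  refine ⟨2 * C / ‖P.coeff 0‖, R, by positivity, hR0, fun n => ?_⟩
  induction n using Nat.strong_induction_on with
  | _ n ih =>
    have h1 := congrArg (PowerSeries.coeff n) h
    rw [PowerSeries.coeff_mul, Finset.Nat.sum_antidiagonal_eq_sum_range_succ_mk,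
      Finset.sum_range_succ'] at h1
    simp only [Polynomial.coeff_coe, Nat.sub_zero] at h1
    have h2 : P.coeff 0 * PowerSeries.coeff n φ = PowerSeries.coeff n γ -
        ∑ k ∈ range n, P.coeff (k + 1) * PowerSeries.coeff (n - (k + 1)) φ := by
      rw [← h1]; ring
    set B := 2 * C / ‖P.coeff 0‖ with hB
    have hB0 : 0 < B := by positivity
    -- The extra factor `R` uses up the drop of the index by at least one.
    have h3 : ‖∑ k ∈ range n, P.coeff (k + 1) * PowerSeries.coeff (n - (k + 1)) φ‖ * R ≤
        S * B * R ^ n := by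
      refine (mul_le_mul_of_nonneg_right (norm_sum_le _ _) hR0.le).trans ?_
      rw [Finset.sum_mul]
      calc ∑ k ∈ range n, ‖P.coeff (k + 1) * PowerSeries.coeff (n - (k + 1)) φ‖ * R
          ≤ ∑ k ∈ range n, ‖P.coeff (k + 1)‖ * (B * R ^ n) := by
            refine Finset.sum_le_sum fun k hk => ?_
            rw [mem_range] at hk
            rw [norm_mul, mul_assoc]
            refine mul_le_mul_of_nonneg_left ?_ (norm_nonneg _)
            calc ‖PowerSeries.coeff (n - (k + 1)) φ‖ * R ≤ B * R ^ (n - (k + 1)) * R := by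
                  gcongr; exact ih _ (by omega)
              _ = B * R ^ (n - (k + 1) + 1) := by rw [pow_succ]; ring
              _ ≤ B * R ^ n := by gcongr; omega
        _ = (∑ k ∈ range n, ‖P.coeff (k + 1)‖) * (B * R ^ n) := by rw [Finset.sum_mul]
        _ ≤ S * (B * R ^ n) := by gcongr; exact hSle n
        _ = _ := by ring
    have h4 : ‖P.coeff 0‖ * ‖PowerSeries.coeff n φ‖ ≤ C * M ^ n +
        ‖∑ k ∈ range n, P.coeff (k + 1) * PowerSeries.coeff (n - (k + 1)) φ‖ := by
      rw [← norm_mul, h2]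
      exact (norm_sub_le _ _).trans (add_le_add (hb n) le_rfl)
    have h5 : C * M ^ n ≤ C * R ^ n := by gcongr
    have h6 : ‖P.coeff 0‖ * B = 2 * C := by rw [hB]; field_simp
    have h7 : ‖∑ k ∈ range n, P.coeff (k + 1) * PowerSeries.coeff (n - (k + 1)) φ‖ ≤
        C * R ^ n := by
      refine le_of_mul_le_mul_right (h3.trans ?_) hR0
      have h8 : S * B ≤ C * R := by
        have : 2 * S * B ≤ ‖P.coeff 0‖ * R * B := by gcongr
        nlinarith
      calc S * B * R ^ n ≤ C * R * R ^ n := by gcongr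
        _ = _ := by ring
    refine le_of_mul_le_mul_left ?_ hP
    rw [← mul_assoc, h6]
    linarith

/-- The Cauchy product; it identifies the quotient by P with the sum of the Borel transform of f
near the origin. -/
lemma eval_mul_eq_of_hasSum {P : Polynomial ℂ} {φ γ : PowerSeries ℂ}
    (h : (P : PowerSeries ℂ) * φ = γ) {x s t : ℂ}
    (hφ : Summable fun n => ‖PowerSeries.coeff n φ * x ^ n‖)
    (hs : HasSum (fun n => PowerSeries.coeff n φ * x ^ n) s)
    (ht : HasSum (fun n => PowerSeries.coeff n γ * x ^ n) t) : P.eval x * s = t := by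
  have hP : HasSum (fun n => P.coeff n * x ^ n) (P.eval x) := by
    rw [Polynomial.eval_eq_sum_range]
    refine hasSum_sum_of_ne_finset_zero fun n hn => ?_
    rw [mem_range, not_lt] at hn
    rw [Polynomial.coeff_eq_zero_of_natDegree_lt (by omega), zero_mul]
  have hPn : Summable fun n => ‖P.coeff n * x ^ n‖ := by
    refine summable_of_ne_finset_zero (s := range (P.natDegree + 1)) fun n hn => ?_
    rw [mem_range, not_lt] at hn
    rw [Polynomial.coeff_eq_zero_of_natDegree_lt (by omega), zero_mul, norm_zero]
  rw [← hP.tsum_eq, ← hs.tsum_eq, ← ht.tsum_eq,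
    tsum_mul_tsum_eq_tsum_sum_antidiagonal_of_summable_norm hPn hφ, ← h]
  congr 1
  ext n
  rw [PowerSeries.coeff_mul, Finset.sum_mul]
  refine Finset.sum_congr rfl fun kl hkl => ?_
  rw [HasAntidiagonal.mem_antidiagonal] at hkl
  rw [Polynomial.coeff_coe, ← hkl, pow_add]; ring

/-- A formal solution is `1`-summable in every direction without roots of `P`. -/
lemma isOneSummable_of_isFormalSolution {P : Polynomial ℂ} {g f : PowerSeries ℂ}
    (h0 : P.eval 0 ≠ 0) (hg : IsConvergent g) (h : IsFormalSolution P g f) {d : ℝ}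
    (hd : ∀ ζ : ℂ, P.IsRoot ζ → ¬ IsArgument d ζ) : IsOneSummable f d := by
  have hP : P ≠ 0 := by rintro rfl; simp at h0
  obtain ⟨C, M, hC, hM, hb⟩ := (isConvergent_iff g).mp hg
  obtain ⟨δ, hδ, hδ', hne⟩ := exists_forall_not_isRoot hP hd
  obtain ⟨c, hc, hlow⟩ := exists_le_norm_eval hδ hne
  obtain ⟨γ, hγd, hγb, hγs⟩ := borel_entire hM hb
  have hmul : (P : PowerSeries ℂ) * borel f = borel g := by rw [← borel_aeval]; exact congrArg _ h
  have hbγ : ∀ n, ‖PowerSeries.coeff n (borel g)‖ ≤ C * M ^ n := fun n => by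
    rw [coeff_borel, norm_div, Complex.norm_natCast]
    exact (div_le_self (norm_nonneg _) (by exact_mod_cast n.factorial_pos)).trans (hb n)
  obtain ⟨B, R, hB, hR, hcoef⟩ := exists_norm_coeff_le_of_mul h0 hmul hC hM hbγ
  refine isOneSummable_of_borel (φ := fun x => γ x / P.eval x) (C := 2 * B + C / c) (A := 4 * R)
    (K := M) hδ hδ' (by positivity) (by positivity) hM
    (fun τ hτ t ht => (hγd _).div P.differentiable.differentiableAt (hne τ hτ t ht))
    fun τ hτ t ht N => ?_
  set x : ℂ := t * Complex.exp (τ * Complex.I) with hx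
  have hxt : ‖x‖ = t := by
    rw [hx, norm_mul, Complex.norm_exp_ofReal_mul_I, Complex.norm_real, Real.norm_of_nonneg ht,
      mul_one]
  have hterm : ∀ p, ‖PowerSeries.coeff p (borel f) * x ^ p‖ ≤ B * (R * t) ^ p := fun p => by
    rw [norm_mul, norm_pow, hxt, mul_pow, ← mul_assoc]
    gcongr
    exact hcoef p
  have he : 1 ≤ Real.exp (M * t) := Real.one_le_exp (by positivity)
  -- For Rt ≤ 1/2 the remainder is a geometric tail. Otherwise value and partial sum are bounded
  -- separately: each term is at most B(2Rt)ᴺ and their number satisfies N ≤ 2ᴺ, whence 4R.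
  rcases le_or_gt (R * t) (1 / 2) with hsmall | hlarge
  · have hsn : Summable fun n => ‖PowerSeries.coeff n (borel f) * x ^ n‖ :=
      Summable.of_nonneg_of_le (fun _ => norm_nonneg _) hterm
        ((summable_geometric_of_lt_one (by positivity) (by linarith)).mul_left B)
    have hs := hsn.of_norm.hasSum
    have heq := eval_mul_eq_of_hasSum hmul hsn hs (hγs x)
    have hval : γ x / P.eval x = ∑' n, PowerSeries.coeff n (borel f) * x ^ n := by
      rw [← heq, mul_div_cancel_left₀ _ (hne τ hτ t ht)]
    rw [← hval] at hs
    refine (hasSum_remainder_le hR.le hcoef (q := 1 / 2) (by rwa [hxt]) (by norm_num) hs N).trans ?_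
    rw [hxt]
    calc B / (1 - 1 / 2) * (R * t) ^ N = 2 * B * R ^ N * t ^ N * 1 := by rw [mul_pow]; ring
      _ ≤ (2 * B + C / c) * (4 * R) ^ N * t ^ N * Real.exp (M * t) := by
        have : 0 ≤ C / c := by positivity
        gcongr <;> linarith
  · have h1 : 1 ≤ 2 * (R * t) := by linarith
    have h2 : ‖γ x / P.eval x‖ ≤ C / c * Real.exp (M * t) := by
      rw [norm_div, div_mul_eq_mul_div]
      have := hγb x
      rw [hxt] at this
      gcongr
      exact hlow τ hτ t ht
    have h3 : ‖∑ p ∈ range N, PowerSeries.coeff p (borel f) * x ^ p‖ ≤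
        B * (4 * (R * t)) ^ N := by
      calc _ ≤ ∑ p ∈ range N, B * (2 * (R * t)) ^ N := by
            refine norm_sum_le_of_le _ fun p hp => (hterm p).trans ?_
            gcongr
            calc (R * t) ^ p ≤ (2 * (R * t)) ^ p :=
                  pow_le_pow_left₀ (by positivity) (by linarith) p
              _ ≤ (2 * (R * t)) ^ N := pow_le_pow_right₀ h1 (mem_range.mp hp).le
        _ = N * (B * (2 * (R * t)) ^ N) := by rw [sum_const, card_range, nsmul_eq_mul]
        _ ≤ 2 ^ N * (B * (2 * (R * t)) ^ N) := by
            gcongr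
            exact_mod_cast N.lt_two_pow_self.le
        _ = _ := by rw [show 4 * (R * t) = 2 * (2 * (R * t)) by ring, mul_pow 2 (2 * (R * t))]; ring
    have h4 : 1 ≤ (4 * (R * t)) ^ N := one_le_pow₀ (by linarith)
    calc _ ≤ C / c * Real.exp (M * t) + B * (4 * (R * t)) ^ N :=
          (norm_sub_le _ _).trans (add_le_add h2 h3)
      _ ≤ C / c * Real.exp (M * t) * (4 * (R * t)) ^ N +
          2 * B * (4 * (R * t)) ^ N * Real.exp (M * t) := by
          apply add_le_add
          · exact le_mul_of_one_le_right (by positivity) h4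
          · refine le_trans ?_ (le_mul_of_one_le_right (by positivity) he)
            gcongr
            linarith
      _ = _ := by rw [← mul_assoc 4 R t, mul_pow (4 * R) t]; ring

/-- Some direction is not the argument of a root of `P`. -/
lemma exists_direction {P : Polynomial ℂ} (h0 : P.eval 0 ≠ 0) :
    ∃ d : ℝ, ∀ ζ : ℂ, P.IsRoot ζ → ¬ IsArgument d ζ := by
  have hP : P ≠ 0 := by rintro rfl; simp at h0
  -- The principal arguments of the roots form a finite set, while (-π, π] is infinite.
  obtain ⟨d, hd, hd'⟩ := (Set.Ioc_infinite (show -Real.pi < Real.pi by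
    linarith [Real.pi_pos])).exists_notMem_finset (P.roots.toFinset.image Complex.arg)
  refine ⟨d, fun ζ hζ harg => hd' ?_⟩
  have hζ0 : ζ ≠ 0 := by rintro rfl; exact h0 hζ
  refine mem_image.mpr ⟨ζ, by simpa [hP] using hζ, ?_⟩
  rw [IsArgument] at harg
  rw [harg, Complex.arg_real_mul _ (norm_pos_iff.mpr hζ0), Complex.arg_exp_mul_I]
  exact (toIocMod_eq_self _).mpr (by convert! hd using 2; ring)

end OneSummability

/-! ### The equivalences -/

theorem mainTheorem2 (fhat : PowerSeries ℂ) (hf : PowerSeries.constantCoeff fhat = 0) :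
    List.TFAE [
      ∃ (P : Polynomial ℂ) (g : PowerSeries ℂ), P.eval 0 ≠ 0 ∧ OneSummability.IsConvergent g ∧
        OneSummability.IsFormalSolution P g fhat,
      ∃ (r : ℕ) (a : ℕ → ℂ) (C M : ℝ), 1 ≤ r ∧ 0 < C ∧ 0 < M ∧ ∀ j : ℕ, r < j →
        ‖PowerSeries.coeff j fhat / (j.factorial : ℂ) -
            ∑ k ∈ Finset.Icc (j - r) (j - 1),
              a (j - k) * (PowerSeries.coeff k fhat / (k.factorial : ℂ))‖ ≤
          C * M ^ j / (j.factorial : ℝ),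
      ∃ (r : ℕ) (a : ℕ → ℂ) (P : Polynomial ℂ) (g : PowerSeries ℂ), 1 ≤ r ∧ P.eval 0 ≠ 0 ∧
        OneSummability.IsConvergent g ∧
        ∀ d : ℝ, (∀ ζ : ℂ, (OneSummability.charPoly r a).IsRoot ζ →
            ¬ OneSummability.IsArgument d ζ) →
          OneSummability.IsOneSummable fhat d ∧
          ∀ (θ ρ : ℝ) (F : ℂ → ℂ), OneSummability.IsOneSum fhat d θ ρ F →
            OneSummability.IsActualSolution P g d θ ρ F] := by
  tfae_have 1 → 2 := by
    rintro ⟨P, g, hP, hg, h⟩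
    exact OneSummability.recurrence_of_isFormalSolution P g fhat hP hg h
  tfae_have 2 → 1 := by
    rintro ⟨r, a, C, M, -, hC, hM, h⟩
    exact OneSummability.isFormalSolution_of_recurrence fhat r a C M hC hM h
  tfae_have 1 → 3 := by
    rintro ⟨P, g, hP, hg, h⟩
    refine ⟨max 1 P.natDegree, fun i => -P.coeff i / P.eval 0, P, g, le_max_left _ _, hP, hg,
      fun d hd => ⟨?_, fun θ ρ F hF => OneSummability.isActualSolution_of_isOneSum h hF⟩⟩
    -- For this choice of a, P = P(0)h, so P and h have the same roots.
    refine OneSummability.isOneSummable_of_isFormalSolution hP hg h fun ζ hζ => hd ζ ?_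
    rw [OneSummability.eq_C_mul_charPoly P hP, Polynomial.IsRoot, Polynomial.eval_mul,
      Polynomial.eval_C] at hζ
    exact (mul_eq_zero.mp hζ).resolve_left hP
  tfae_have 3 → 1 := by
    rintro ⟨r, a, P, g, -, hP, hg, h⟩
    -- An admissible direction keeps (3) from being vacuous; no relation between h and P is needed.
    obtain ⟨d, hd⟩ := OneSummability.exists_direction (P := OneSummability.charPoly r a)
      (by rw [OneSummability.eval_zero_charPoly]; exact one_ne_zero)
    obtain ⟨⟨θ, ρ, F, hF⟩, hsol⟩ := h d hd
    exact ⟨P, g, hP, hg,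
      OneSummability.isFormalSolution_of_isActualSolution hg hF (hsol θ ρ F hF)⟩
  tfae_finish
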